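/- A Motzkin path of width $n$ is a sequence of $n$ moves $U=(1,1)$, $H=(1,0)$, $D=(1,-1)$ starting at $(0,0)$ that never goes below the axis $y=0$ and ends on it; its area $A$ is the area of the region between the axis and the path, and its last fall is its longest suffix of $D$ moves. Its weight $\omega$ is the product over its moves of $h$ for a move $U$ or $D$ and of $2h+1$ for a move $H$, where $h$ is the maximum height of the path during the move. Let $M(n,A)$ be the number of Motzkin paths of width $n$ and area $A$, and let $D(n,d)$ be the number of permutations $\pi$ of $\{1,\dots,n\}$ with $\sum_{i=1}^n|i-\pi(i)|=2d$. (1) On a unit-cost random access machine (with constants, copying, addition, truncated subtraction, multiplication, indirect loads and stores, and zero tests), there is a program that, for all $n,A\ge 0$, computes $M(n,A)$ from the input $(n,A)$ in time $O(n^4)$ and space $O(n^3)$, and there is a program that, for all $n,d\ge 0$, computes $D(n,d)$ from the input $(n,d)$ in time $O(n^4)$ and space $O(n^3)$. Besides the requested value, the programs output the whole row $M(n,0),\dots,M(n,n^2)$, respectively $D(n,0),\dots,D(n,n^2)$. The constants do not depend on $n$, $A$, $d$ (read $n+1$ for $n$ in the bounds, to cover $n=0$); space is measured by the largest memory address accessed,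 and every number computed is at most $(n+2)^{C(n+1)}+a$ for a constant $C$, where $a$ is the second input, so that it has $O(n\log n)$ bits apart from the size of that input. (2) Let $M(n,A,l)$ be the number, and $D(n,d,l)$ the total weight, of the Motzkin paths of width $n$, area $A$ (respectively $d$) and last-fall length $l$, both being $0$ if a parameter is negative. Then $$M(n,A)=\sum_{l=0}^{n}M(n,A,l),\qquad D(n,d)=\sum_{l=0}^{n}D(n,d,l)\qquad(n,A,d\ge 0),$$ for $n\le 0$ the only nonzero values are $M(0,0,0)=D(0,0,0)=1$, and for all integers $n\ge 1$, $l\ge 0$ and $A,d$, $$M(n,A,l)=\sum_{l'=l}^{\lfloor n/2\rfloor}M(n-1,A-l,l')+[l\ge 1]\sum_{l'=l-1}^{\lfloor n/2\rfloor}M(n-2,A-(2l-1),l'),$$ $$D(n,d,l)=(2l+1)\sum_{l'=l}^{\lfloor n/2\rfloor}D(n-1,d-l,l')+l^2\sum_{l'=l-1}^{\lfloor n/2\rfloor}D(n-2,d-(2l-1),l').$$ -/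

import Mathlib

namespace MotzkinDP

/-! ## Motzkin paths -/

/-- The three moves: up-right, horizontal-right, down-right. -/
inductive Move where
  | U | H | D
  deriving DecidableEq

/-- The change of height caused by a move. -/
def Move.dy : Move → ℤ
  | .U => 1
  | .H => 0
  | .D => -1

/-- The final height of a path (a list of moves) that starts at height `0`. -/
def height (p : List Move) : ℤ := (p.map Move.dy).sum

/-- A Motzkin path never goes below the axis and ends on the axis. -/
def IsMotzkin (p : List Move) : Prop :=
  (∀ q, q <+: p → 0 ≤ height q) ∧ height p = 0

/-- The area between the axis and a path that starts at height `h`: a move from height `h` to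
height `h'` has a trapezoid of area `(h + h') / 2` below it. -/
def areaFrom (h : ℤ) : List Move → ℚ
  | [] => 0
  | x :: p => ((h : ℚ) + ((h + x.dy : ℤ) : ℚ)) / 2 + areaFrom (h + x.dy) p

/-- The area between the axis and a path that starts at height `0`. -/
def area (p : List Move) : ℚ := areaFrom 0 p

/-- The weight factor of a move that starts at height `h`. With `m` the maximum height of the path
during that move, it is `m` for the moves `U` and `D`, and `2 * m + 1` for the move `H`. -/
def Move.factor (h : ℤ) : Move → ℤ
  | .U => h + 1
  | .H => 2 * h + 1
  | .D => h

/-- The product of the weight factors of the moves of a path that starts at height `h`. -/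
def weightFrom (h : ℤ) : List Move → ℤ
  | [] => 1
  | x :: p => x.factor h * weightFrom (h + x.dy) p

/-- The weight of a path that starts at height `0`. -/
def weight (p : List Move) : ℤ := weightFrom 0 p

/-- The length of the last fall of a path, its longest suffix of `D` moves. -/
def lastFall (p : List Move) : ℕ := (p.rtakeWhile (fun x => x = Move.D)).length

/-- `M(n, A)`: the number of Motzkin paths of width `n` and area `A`. -/
noncomputable def motzkinCount (n A : ℕ) : ℕ :=
  {p : List Move | IsMotzkin p ∧ p.length = n ∧ area p = A}.ncard

/-- The (finite) set of the Motzkin paths of width `n`, area `A` and last-fall length `l`. The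
parameters are integers; the set is empty if one of them is negative. -/
def lastFallPaths (n A l : ℤ) : Set (List Move) :=
  {p | IsMotzkin p ∧ (p.length : ℤ) = n ∧ area p = A ∧ (lastFall p : ℤ) = l}

/-- `M(n, A, l)`: the number of Motzkin paths of width `n`, area `A` and last-fall length `l`. -/
noncomputable def lastFallCount (n A l : ℤ) : ℕ := (lastFallPaths n A l).ncard

/-- `D(n, d, l)`: the total weight of the Motzkin paths of width `n`, area `d` and last-fall
length `l`. -/
noncomputable def lastFallWeight (n d l : ℤ) : ℤ := ∑ᶠ p ∈ lastFallPaths n d l, weight p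

/-! ## Total displacement of permutations -/

/-- The total displacement of a permutation, `∑ |i - π(i)|`. -/
def displacement {n : ℕ} (π : Equiv.Perm (Fin n)) : ℤ :=
  ∑ i : Fin n, |((i : ℕ) : ℤ) - ((π i : ℕ) : ℤ)|

/-- `D(n, d)`: the number of permutations of `n` elements of total displacement `2 * d`. -/
def displacementCount (n d : ℕ) : ℕ :=
  (Finset.univ.filter fun π : Equiv.Perm (Fin n) => displacement π = 2 * (d : ℤ)).card

/-! ## The unit-cost random access machine -/

/-- The arithmetic operations of the machine. -/
inductive Op where
  | add | sub | mul

/-- The value of an operation; subtraction is truncated at `0`. -/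
def Op.eval : Op → ℕ → ℕ → ℕ
  | .add, x, y => x + y
  | .sub, x, y => x - y
  | .mul, x, y => x * y

/-- Programs of a random access machine, in structured form. Registers have fixed names, so that
a program uses only finitely many of them; the cells of the memory are addressed indirectly, by
the contents of a register. -/
inductive Prog where
  /-- `R[r] := c` -/
  | const (r c : ℕ)
  /-- `R[r] := R[a]` -/
  | move (r a : ℕ)
  /-- `R[r] := R[a] o R[b]` -/
  | arith (o : Op) (r a b : ℕ)
  /-- `R[r] := mem[R[a]]` -/
  | load (r a : ℕ)
  /-- `mem[R[a]] := R[r]` -/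
  | store (a r : ℕ)
  /-- run `P`, then `Q` -/
  | seq (P Q : Prog)
  /-- if `R[r] ≠ 0` then `P` else `Q` -/
  | cond (r : ℕ) (P Q : Prog)
  /-- while `R[r] ≠ 0` do `P` -/
  | loop (r : ℕ) (P : Prog)

/-- A state of the machine: the contents of the registers and of the memory cells. -/
structure State where
  reg : ℕ → ℕ
  mem : ℕ → ℕ

/-- The state after the assignment `R[r] := v`. -/
def State.setReg (s : State) (r v : ℕ) : State := { s with reg := Function.update s.reg r v }

/-- The state after the assignment `mem[a] := v`. -/
def State.setMem (s : State) (a v : ℕ) : State := { s with mem := Function.update s.mem a v }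

/-- `Run m w P s t s'`: the program `P`, started in the state `s`, halts in the state `s'` after
exactly `t` steps, accesses only memory cells with addresses below `m`, and never computes a
number larger than `w`. Every assignment and every evaluation of a test is one step. (The
instructions without a bound by `w` only copy numbers that are already present.) -/
inductive Run (m w : ℕ) : Prog → State → ℕ → State → Prop
  | const (s : State) (r c : ℕ) (hw : c ≤ w) :
      Run m w (.const r c) s 1 (s.setReg r c)
  | move (s : State) (r a : ℕ) :
      Run m w (.move r a) s 1 (s.setReg r (s.reg a))
  | arith (s : State) (o : Op) (r a b : ℕ) (hw : o.eval (s.reg a) (s.reg b) ≤ w) :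
      Run m w (.arith o r a b) s 1 (s.setReg r (o.eval (s.reg a) (s.reg b)))
  | load (s : State) (r a : ℕ) (hm : s.reg a < m) :
      Run m w (.load r a) s 1 (s.setReg r (s.mem (s.reg a)))
  | store (s : State) (a r : ℕ) (hm : s.reg a < m) :
      Run m w (.store a r) s 1 (s.setMem (s.reg a) (s.reg r))
  | seq {P Q : Prog} {s s₁ s₂ : State} {t₁ t₂ : ℕ} (h₁ : Run m w P s t₁ s₁)
      (h₂ : Run m w Q s₁ t₂ s₂) : Run m w (.seq P Q) s (t₁ + t₂) s₂
  | condTrue {r : ℕ} {P Q : Prog} {s s' : State} {t : ℕ} (hr : s.reg r ≠ 0)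
      (h : Run m w P s t s') : Run m w (.cond r P Q) s (t + 1) s'
  | condFalse {r : ℕ} {P Q : Prog} {s s' : State} {t : ℕ} (hr : s.reg r = 0)
      (h : Run m w Q s t s') : Run m w (.cond r P Q) s (t + 1) s'
  | loopDone {r : ℕ} {P : Prog} {s : State} (hr : s.reg r = 0) :
      Run m w (.loop r P) s 1 s
  | loopStep {r : ℕ} {P : Prog} {s s₁ s₂ : State} {t₁ t₂ : ℕ} (hr : s.reg r ≠ 0)
      (h₁ : Run m w P s t₁ s₁) (h₂ : Run m w (.loop r P) s₁ t₂ s₂) :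
      Run m w (.loop r P) s (t₁ + 1 + t₂) s₂

/-- The initial state with the input `(x, y)` in the registers `0` and `1`; all other registers
and all memory cells hold `0`. -/
def initState (x y : ℕ) : State where
  reg := fun r => if r = 0 then x else if r = 1 then y else 0
  mem := fun _ => 0

/-- The program `P` computes the function `f` of two arguments in time `O(n ^ 4)` and space
`O(n ^ 3)`, where `n` is the first argument, on numbers of `O(n * log n)` bits (besides the input):
on every input `(n, a)` it halts with the output `f n a` in register `0` and the whole row
`f n 0, …, f n (n ^ 2)` in the memory cells `0, …, n ^ 2`. The constant `C` depends neither on `n`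
nor on `a`. -/
def ComputesInQuarticTimeCubicSpace (P : Prog) (f : ℕ → ℕ → ℕ) : Prop :=
  ∃ C : ℕ, ∀ n a : ℕ, ∃ (t : ℕ) (s : State),
    t ≤ C * (n + 1) ^ 4 ∧
    Run (C * (n + 1) ^ 3) ((n + 2) ^ (C * (n + 1)) + a) P (initState n a) t s ∧
    s.reg 0 = f n a ∧
    ∀ j ≤ n ^ 2, s.mem j = f n j

end MotzkinDP

namespace MotzkinDP

/-! ## Paths from a given height down to the axis -/

/-! The area below a path ending on the axis is the sum of the starting heights of its moves minus
half its initial height, since the trapezoid areas telescope. So paths can be counted by remaining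
moves `k`, height `h` and sum `s` of starting heights, and splitting off the first move gives the
three-term recurrence `transfer`. With about `n` layers, `n` heights and `n ^ 2` sums, at constant
cost per entry, this takes time `O(n ^ 4)`. A layer depends only on the previous one and can
overwrite it, so space `O(n ^ 3)` suffices.

For permutations, `|i - π i|` counts the cuts between `j` and `j + 1` that separate `i` from `π i`.
Each cut is crossed equally often in both directions, namely as often as there are rows without a
rook in the upper left square of side `j + 1` of the permutation matrix (`displacement_eq`). Growing
this square by a row and a column, when it has `g` free rows, adds no rook in 1 way, one rook in `2
* g + 1` ways and two rooks in `g ^ 2` ways (`sum_rooks_succ`). Multiplying the counts by `h !`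
turns these numbers into the weights `h + 1`, `2 * h + 1`, `h` of the Motzkin moves
(`factorial_mul_rookCount`), so `D(n, d)` is an instance of `transfer` too.

The recurrences by last fall are a separate bijection: before a last fall of length `l` stands an
`H` at height `l`, or a `U` reaching it. Deleting the `H`, or the `U` with one `D` of the fall,
leaves a path that ends in at least `l`, respectively `l - 1`, moves `D`. This is reversible
(`insert_H_mem`, `insert_U_mem`) and changes area and weight by amounts depending on `l` only. -/

/-- The weighted number of `k`-step paths from height `h` to height `0` whose moves start at
heights of sum `s`, with weights `u`, `m`, `d` for the up, horizontal and down moves. -/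
def transfer (u m d : ℕ → ℕ) : ℕ → ℕ → ℕ → ℕ
  | 0, h, s => if h = 0 ∧ s = 0 then 1 else 0
  | k + 1, h, s =>
    if h ≤ s then
      u h * transfer u m d k (h + 1) (s - h) + m h * transfer u m d k h (s - h) +
        d h * transfer u m d k (h - 1) (s - h)
    else 0

/-- A move descends by at most one. This also makes row `n + 1` of the table vanish in all layers,
so it serves as a border that is never rewritten. -/
theorem transfer_eq_zero_of_lt {u m d : ℕ → ℕ} {k h : ℕ} (hk : k < h) (s : ℕ) :
    transfer u m d k h s = 0 := by
  induction k generalizing h s with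
  | zero => simp [transfer]; omega
  | succ k ih =>
    simp only [transfer]
    split_ifs
    · rw [ih (by omega), ih (by omega), ih (by omega)]; simp
    · rfl

/-- Only heights up to the number of remaining moves contribute, hence the crude bound `k ^ 2` on
their sum. It justifies the output 0 for a second input beyond `n ^ 2`. -/
theorem transfer_eq_zero_of_sq_lt {u m d : ℕ → ℕ} {k s : ℕ} (hk : k ^ 2 < s)
    (h : ℕ) : transfer u m d k h s = 0 := by
  induction k generalizing h s with
  | zero => simp [transfer]; omega
  | succ k ih =>
    by_cases hh : k + 1 < h
    · exact transfer_eq_zero_of_lt hh s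
    · simp only [transfer]
      have : k ^ 2 < s - h := by
        have : (k + 1) ^ 2 = k ^ 2 + 2 * k + 1 := by ring
        omega
      split_ifs
      · rw [ih this, ih this, ih this]; simp
      · rfl

theorem transfer_le {u m d : ℕ → ℕ} {B n : ℕ}
    (hB : ∀ h ≤ n, u h + m h + d h ≤ B) {k : ℕ} (hk : k ≤ n) (h s : ℕ) :
    transfer u m d k h s ≤ B ^ k := by
  induction k generalizing h s with
  | zero => simp only [transfer]; split_ifs <;> simp
  | succ k ih =>
    by_cases hh : k + 1 < h
    · rw [transfer_eq_zero_of_lt hh s]; exact Nat.zero_le _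
    · simp only [transfer]
      split_ifs
      · have ih := ih (by omega)
        calc _ ≤ u h * B ^ k + m h * B ^ k + d h * B ^ k := by
              gcongr <;> exact ih _ _
          _ = (u h + m h + d h) * B ^ k := by ring
          _ ≤ B * B ^ k := by gcongr; exact hB h (by omega)
          _ = B ^ (k + 1) := by ring
      · exact Nat.zero_le _

/-- The paths counted by `transfer`. -/
def descents : ℕ → ℕ → ℕ → Finset (List Move)
  | 0, h, s => if h = 0 ∧ s = 0 then {[]} else ∅
  | k + 1, h, s =>
    if h ≤ s then
      (descents k (h + 1) (s - h)).image (List.cons .U) ∪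
        (descents k h (s - h)).image (List.cons .H) ∪
        if h = 0 then ∅ else (descents k (h - 1) (s - h)).image (List.cons .D)
    else ∅

/-- Only the behaviour of `F` on the first move matters, so one induction serves both the number of
paths and their weight. The condition `d 0 = 0` removes the term that the truncated `h - 1` would
produce on the axis. -/
theorem sum_descents {u m d : ℕ → ℕ} (hd : d 0 = 0) (F : ℕ → List Move → ℤ)
    (h0 : F 0 [] = 1)
    (hU : ∀ h p, F h (.U :: p) = u h * F (h + 1) p)
    (hH : ∀ h p, F h (.H :: p) = m h * F h p)
    (hD : ∀ h p, F (h + 1) (.D :: p) = d (h + 1) * F h p) (k h s : ℕ) :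
    ∑ p ∈ descents k h s, F h p = transfer u m d k h s := by
  induction k generalizing h s with
  | zero =>
    simp only [descents, transfer]
    split_ifs with hc
    · simp [hc.1, h0]
    · simp
  | succ k ih =>
    have inj (x : Move) (S : Set (List Move)) : Set.InjOn (List.cons x) S := by
      intro a _ b _ hab; simpa using hab
    simp only [descents, transfer]
    split_ifs with hs hz
    · subst hz
      rw [Finset.union_empty, Finset.sum_union, Finset.sum_image (inj _ _),
        Finset.sum_image (inj _ _)]
      · simp [hU, hH, ← Finset.mul_sum, ih, hd]
      · rw [Finset.disjoint_left]; simp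
    · obtain ⟨g, rfl⟩ := Nat.exists_eq_succ_of_ne_zero hz
      rw [Finset.sum_union, Finset.sum_union, Finset.sum_image (inj _ _),
        Finset.sum_image (inj _ _), Finset.sum_image (inj _ _)]
      · simp [hU, hH, hD, ← Finset.mul_sum, ih]
      · rw [Finset.disjoint_left]; simp
      · rw [Finset.disjoint_left]; aesop
    · simp

theorem height_cons (x : Move) (p : List Move) : height (x :: p) = x.dy + height p := by
  simp [height]

theorem height_append (p q : List Move) : height (p ++ q) = height p + height q := by
  simp [height]

theorem forall_prefix_cons {P : List Move → Prop} {x : Move} {p : List Move} :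
    (∀ q, q <+: x :: p → P q) ↔ P [] ∧ ∀ q, q <+: p → P (x :: q) := by
  constructor
  · exact fun h => ⟨h _ List.nil_prefix, fun q hq => h _ (by simpa using hq)⟩
  · rintro ⟨h0, h1⟩ q hq
    rcases List.prefix_cons_iff.1 hq with rfl | ⟨t, rfl, ht⟩
    · exact h0
    · exact h1 t ht

/-- Adding the half-sums of consecutive heights counts every starting height once, except that the
initial one is counted by half; the final height is 0. At `h = 0` the parameter `s` is therefore the
area itself. -/
theorem mem_descents {k h s : ℕ} {p : List Move} :
    p ∈ descents k h s ↔ ((∀ q, q <+: p → 0 ≤ (h : ℤ) + height q) ∧ (h : ℤ) + height p = 0) ∧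
      p.length = k ∧ areaFrom h p = s - (h : ℚ) / 2 := by
  induction k generalizing h s p with
  | zero =>
    simp only [descents]
    split_ifs with hc
    · obtain ⟨rfl, rfl⟩ := hc
      simp only [Finset.mem_singleton]
      constructor
      · rintro rfl; simp [height, areaFrom]
      · exact fun hp => List.length_eq_zero_iff.1 hp.2.1
    · simp only [Finset.notMem_empty, false_iff]
      rintro ⟨⟨-, h1⟩, h2, h3⟩
      rw [List.length_eq_zero_iff] at h2
      subst h2
      simp [height] at h1
      subst h1
      simp [areaFrom] at h3
      exact hc ⟨rfl, by exact_mod_cast h3.symm⟩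
  | succ k ih =>
    rcases p with _ | ⟨x, p⟩
    · simp only [descents]; split_ifs <;> simp
    have key : h ≤ s → ∀ g : ℕ, (g : ℤ) = h + x.dy →
        (p ∈ descents k g (s - h) ↔
          ((∀ q, q <+: x :: p → 0 ≤ (h : ℤ) + height q) ∧ (h : ℤ) + height (x :: p) = 0) ∧
      (x :: p).length = k + 1 ∧ areaFrom h (x :: p) = s - (h : ℚ) / 2) := by
      intro hs g hg
      have hg' : (h : ℚ) + ((x.dy : ℤ) : ℚ) = g := by exact_mod_cast hg.symm
      rw [ih, forall_prefix_cons, height_cons]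
      simp only [height_cons, areaFrom, List.length_cons, ← add_assoc, ← hg]
      simp only [show height [] = 0 from rfl]
      refine and_congr (and_congr ?_ Iff.rfl) (and_congr (by omega) ?_)
      · simp
      · push_cast [hs]
        rw [hg]
        constructor <;> intro h <;> linarith
    -- Applied to the path after its first move, this bound forces `h ≤ s`; so the branch `s < h` is
    -- rightly empty.
    have low : ∀ (p : List Move) (h : ℤ), (∀ q, q <+: p → 0 ≤ h + height q) →
        h + height p = 0 → (h : ℚ) / 2 ≤ areaFrom h p := by
      intro p
      induction p with
      | nil => intro h h1 h2; simp [height] at h2; simp [h2, areaFrom]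
      | cons x p ihp =>
        intro h h1 h2
        rw [forall_prefix_cons] at h1
        have := ihp (h + x.dy) (fun q hq => by
          have := h1.2 q hq; rw [height_cons] at this; linarith)
          (by rw [height_cons] at h2; linarith)
        have h3 := h1.2 [] List.nil_prefix
        rw [height_cons] at h3
        simp [height] at h3
        have h3 : (0 : ℚ) ≤ ((h + x.dy : ℤ) : ℚ) := by exact_mod_cast h3
        simp only [areaFrom]
        push_cast at *
        linarith
    by_cases hs : h ≤ s
    · have key := key hs
      simp only [descents, if_pos hs]
      cases x
      · rw [← key (h + 1) (by simp [Move.dy])]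
        split_ifs <;> simp
      · rw [← key h (by simp [Move.dy])]
        split_ifs <;> simp
      · rcases Nat.eq_zero_or_pos h with rfl | hpos
        · simp only [if_true, Finset.union_empty]
          constructor
          · simp
          · rintro ⟨⟨h1, -⟩, -⟩
            have := h1 [Move.D] (by simp)
            simp [height, Move.dy] at this
        · rw [← key (h - 1) (by simp [Move.dy]; omega), if_neg (by omega)]
          simp
    · simp only [descents, if_neg hs, Finset.notMem_empty, false_iff]
      rintro ⟨⟨h1, h2⟩, -, h3⟩
      rw [forall_prefix_cons] at h1
      have := low p (h + x.dy) (fun q hq => by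
          have := h1.2 q hq; rw [height_cons] at this; linarith)
          (by rw [height_cons] at h2; linarith)
      simp only [areaFrom] at h3
      have h3' := h1.2 [] List.nil_prefix
      rw [height_cons] at h3'
      simp [height] at h3'
      have h3' : (0 : ℚ) ≤ ((h + x.dy : ℤ) : ℚ) := by exact_mod_cast h3'
      have hs : (s : ℚ) < h := by exact_mod_cast not_le.1 hs
      push_cast at *
      linarith

theorem mem_descents_zero {n A : ℕ} {p : List Move} :
    p ∈ descents n 0 A ↔ IsMotzkin p ∧ p.length = n ∧ area p = A := by
  rw [mem_descents]; simp [IsMotzkin, area]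

theorem motzkinCount_eq_card (n A : ℕ) : motzkinCount n A = (descents n 0 A).card := by
  rw [motzkinCount, ← Set.ncard_coe_finset]
  congr 1
  ext p
  simp [mem_descents_zero]

theorem motzkinCount_eq_transfer {d : ℕ → ℕ} (hd : d 0 = 0) (hd' : ∀ h, d (h + 1) = 1)
    (n A : ℕ) : motzkinCount n A = transfer (fun _ => 1) (fun _ => 1) d n 0 A := by
  have := sum_descents (u := fun _ => 1) (m := fun _ => 1) hd (fun _ _ => 1) rfl (by simp) (by simp)
    (by simp [hd']) n 0 A
  rw [motzkinCount_eq_card]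
  simpa using this

theorem sum_weight_descents (n A : ℕ) :
    ∑ p ∈ descents n 0 A, weight p =
      transfer (fun h => h + 1) (fun h => 2 * h + 1) (fun h => h) n 0 A := by
  have := sum_descents (u := fun h => h + 1) (m := fun h => 2 * h + 1) (d := fun h => h) rfl
    (fun h p => weightFrom h p) rfl
    (fun h p => by simp [weightFrom, Move.factor, Move.dy])
    (fun h p => by simp [weightFrom, Move.factor, Move.dy])
    (fun h p => by simp [weightFrom, Move.factor, Move.dy]) n 0 A
  simpa [weight] using this

/-! ## The recurrence by the length of the last fall -/

instance : Finite Move :=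
  @Finite.of_fintype _ ⟨{.U, .H, .D}, by rintro (_ | _ | _) <;> simp⟩

/-- A path from height `h` that never goes below the axis. -/
def Nonneg (h : ℤ) (p : List Move) : Prop := ∀ q, q <+: p → 0 ≤ h + height q

theorem nonneg_nil {h : ℤ} : Nonneg h [] ↔ 0 ≤ h := by simp [Nonneg, height]

theorem nonneg_cons {h : ℤ} {x : Move} {p : List Move} :
    Nonneg h (x :: p) ↔ 0 ≤ h ∧ Nonneg (h + x.dy) p := by
  simp only [Nonneg]
  rw [forall_prefix_cons]
  simp [height_cons, ← add_assoc, show height [] = 0 from rfl]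

theorem nonneg_of_nonneg {h : ℤ} {p : List Move} (hp : Nonneg h p) : 0 ≤ h := by
  simpa [height] using hp [] List.nil_prefix

theorem nonneg_append {h : ℤ} {p q : List Move} :
    Nonneg h (p ++ q) ↔ Nonneg h p ∧ Nonneg (h + height p) q := by
  induction p generalizing h with
  | nil =>
    simp only [List.nil_append, nonneg_nil, show height [] = 0 from rfl, add_zero]
    exact ⟨fun hq => ⟨nonneg_of_nonneg hq, hq⟩, fun hq => hq.2⟩
  | cons x p ih =>
    rw [List.cons_append, nonneg_cons, nonneg_cons, ih, height_cons, add_assoc, and_assoc]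

theorem isMotzkin_iff {p : List Move} : IsMotzkin p ↔ Nonneg 0 p ∧ height p = 0 := by
  simp [IsMotzkin, Nonneg]

theorem areaFrom_append (h : ℤ) (p q : List Move) :
    areaFrom h (p ++ q) = areaFrom h p + areaFrom (h + height p) q := by
  induction p generalizing h with
  | nil => simp [areaFrom, height]
  | cons x p ih =>
    rw [List.cons_append, areaFrom, areaFrom, ih, height_cons]; rw [add_assoc h]; ring

theorem weightFrom_append (h : ℤ) (p q : List Move) :
    weightFrom h (p ++ q) = weightFrom h p * weightFrom (h + height p) q := by
  induction p generalizing h with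
  | nil => simp [weightFrom, height]
  | cons x p ih =>
    rw [List.cons_append, weightFrom, weightFrom, ih, height_cons]; rw [add_assoc h]; ring

/-- `l` moves down. -/
abbrev fall (l : ℕ) : List Move := List.replicate l Move.D

theorem height_fall (l : ℕ) : height (fall l) = -l := by
  simp [height, fall, Move.dy]

theorem nonneg_fall (l : ℕ) : Nonneg l (fall l) := by
  induction l with
  | zero => simp [fall, nonneg_nil]
  | succ l ih =>
    rw [fall, List.replicate_succ, nonneg_cons]
    refine ⟨by positivity, ?_⟩
    simpa [Move.dy] using ih

theorem isMotzkin_append_fall {q : List Move} {l : ℕ} :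
    IsMotzkin (q ++ fall l) ↔ Nonneg 0 q ∧ height q = l := by
  rw [isMotzkin_iff, nonneg_append, height_append, height_fall]
  constructor
  · rintro ⟨⟨h1, -⟩, h2⟩; exact ⟨h1, by linarith⟩
  · rintro ⟨h1, h2⟩
    refine ⟨⟨h1, ?_⟩, by linarith⟩
    rw [h2, zero_add]; exact nonneg_fall l

theorem lastFall_concat (p : List Move) (x : Move) :
    lastFall (p ++ [x]) = if x = .D then lastFall p + 1 else 0 := by
  simp only [lastFall, List.rtakeWhile_concat]
  split_ifs <;> simp_all

theorem lastFall_append_fall (p : List Move) (l : ℕ) :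
    lastFall (p ++ fall l) = lastFall p + l := by
  induction l with
  | zero => simp [fall]
  | succ l ih =>
    rw [fall, List.replicate_succ', ← List.append_assoc, lastFall_concat, if_pos rfl, ih]; rfl

theorem exists_eq_append_fall (p : List Move) :
    ∃ q, p = q ++ fall (lastFall p) ∧ (q = [] ∨ ∃ r x, x ≠ Move.D ∧ q = r ++ [x]) := by
  induction p using List.reverseRecOn with
  | nil => exact ⟨[], by simp [lastFall], Or.inl rfl⟩
  | append_singleton p x ih =>
    rw [lastFall_concat]
    split_ifs with hx
    · obtain ⟨q, hq, hq'⟩ := ih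
      refine ⟨q, ?_, hq'⟩
      subst hx
      rw [fall, List.replicate_succ', ← List.append_assoc, ← hq]
    · exact ⟨p ++ [x], by simp, Or.inr ⟨p, x, hx, rfl⟩⟩

theorem height_le_length (p : List Move) : height p ≤ p.length := by
  induction p with
  | nil => simp [height]
  | cons x p ih =>
    rw [height_cons]; cases x <;> simp [Move.dy] <;> omega

/-- Climbing to the height from which the last fall starts takes at least as many moves as the fall.
Hence the upper limit `n / 2` of the sums loses nothing. -/
theorem two_mul_lastFall_le {p : List Move} (hp : IsMotzkin p) : 2 * lastFall p ≤ p.length := by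
  obtain ⟨q, hq, -⟩ := exists_eq_append_fall p
  have h1 : IsMotzkin (q ++ fall (lastFall p)) := hq ▸ hp
  have h2 := congrArg List.length hq
  have h3 := height_le_length q
  rw [(isMotzkin_append_fall.1 h1).2] at h3
  simp at h2
  omega

theorem finite_lastFallPaths (n A l : ℤ) : (lastFallPaths n A l).Finite :=
  (List.finite_length_eq Move n.toNat).subset fun p hp => by
    have := hp.2.1
    simp only [Set.mem_ofPred_eq]; omega

/-! ### Inserting moves before the last fall -/

/-- The paths that become Motzkin paths of width `n` and area `A` by appending `l` moves down. -/
def truncatedPaths (n A : ℤ) (l : ℕ) : Set (List Move) :=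
  {q | IsMotzkin (q ++ fall l) ∧ ((q ++ fall l).length : ℤ) = n ∧ area (q ++ fall l) = A}

theorem finite_truncatedPaths (n A : ℤ) (l : ℕ) : (truncatedPaths n A l).Finite :=
  (List.finite_length_le Move n.toNat).subset fun p hp => by
    have := hp.2.1
    simp at this
    simp only [Set.mem_ofPred_eq]; omega

/-- A last fall of length at least `l` just means that the path ends in `l` moves `D`, and
cancelling this suffix is injective. -/
theorem sum_lastFallPaths (W : List Move → ℤ) {n m : ℤ} (hm : n / 2 ≤ m) (A : ℤ) (l : ℕ) :
    ∑ k ∈ Finset.Icc (l : ℤ) m, ∑ᶠ p ∈ lastFallPaths n A k, W p =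
      ∑ᶠ q ∈ truncatedPaths n A l, W (q ++ fall l) := by
  rw [← finsum_mem_image (g := fun q => q ++ fall l) (f := W)
    (fun a _ b _ hab => List.append_cancel_right hab), ← finsum_mem_coe_finset,
    ← finsum_mem_biUnion]
  · refine finsum_mem_congr (Set.ext fun p => ?_) fun _ _ => rfl
    simp only [Set.mem_iUnion, Set.mem_image, truncatedPaths, Set.mem_ofPred_eq, Finset.coe_Icc,
      Set.mem_Icc, exists_prop]
    constructor
    · rintro ⟨k, ⟨hk, -⟩, h1, h2, h3, h4⟩
      obtain ⟨q, hq, -⟩ := exists_eq_append_fall p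
      obtain ⟨j, hj⟩ : ∃ j, lastFall p = j + l := ⟨lastFall p - l, by omega⟩
      have : p = (q ++ fall j) ++ fall l := by
        rw [hj] at hq
        rw [hq, fall, List.replicate_add, List.append_assoc]
      exact ⟨q ++ fall j, ⟨this ▸ h1, this ▸ h2, this ▸ h3⟩, this.symm⟩
    · rintro ⟨q, ⟨h1, h2, h3⟩, rfl⟩
      have := two_mul_lastFall_le h1
      refine ⟨lastFall (q ++ fall l), ⟨?_, by omega⟩, h1, h2, h3, rfl⟩
      rw [lastFall_append_fall]; omega
  · intro a _ b _ hab
    rw [Function.onFun, Set.disjoint_left]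
    intro p hp hp'
    exact hab (hp.2.2.2.symm.trans hp'.2.2.2)
  · exact Finset.finite_toSet _
  · exact fun k _ => finite_lastFallPaths _ _ _

theorem area_insert_H {q : List Move} {l : ℕ} (hq : height q = l) :
    area (q ++ .H :: fall l) = area (q ++ fall l) + l := by
  simp [area, areaFrom_append, areaFrom, hq, Move.dy]; ring

/-- The insertion amounts to a peak `U D` on height `l`, made of two trapezoids of area `l + 1/2`.
-/
theorem area_insert_U {q : List Move} {l : ℕ} (hq : height q = l) :
    area (q ++ .U :: fall (l + 1)) = area (q ++ fall l) + (2 * l + 1) := by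
  simp [area, areaFrom_append, areaFrom, hq, Move.dy, List.replicate_succ]; ring

theorem weight_insert_H {q : List Move} {l : ℕ} (hq : height q = l) :
    weight (q ++ .H :: fall l) = (2 * l + 1) * weight (q ++ fall l) := by
  simp [weight, weightFrom_append, weightFrom, hq, Move.dy, Move.factor]; ring

theorem weight_insert_U {q : List Move} {l : ℕ} (hq : height q = l) :
    weight (q ++ .U :: fall (l + 1)) = (l + 1) ^ 2 * weight (q ++ fall l) := by
  simp [weight, weightFrom_append, weightFrom, hq, Move.dy, Move.factor, List.replicate_succ]; ring

theorem mem_lastFallPaths_append {n A : ℤ} {l : ℕ} {r : List Move} {x : Move} (hx : x ≠ .D) :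
    r ++ x :: fall l ∈ lastFallPaths n A l ↔ IsMotzkin (r ++ x :: fall l) ∧
      ((r ++ x :: fall l).length : ℤ) = n ∧ area (r ++ x :: fall l) = A := by
  have : lastFall (r ++ x :: fall l) = l := by
    rw [List.append_cons, lastFall_append_fall, lastFall_concat, if_neg hx, zero_add]
  simp [lastFallPaths, this]

/-- The inserted move cuts off the fall: the longer path has last fall exactly `l`, whereas `q ++
fall l` may have a longer one. -/
theorem insert_H_mem {n A : ℤ} {l : ℕ} {q : List Move} :
    q ++ .H :: fall l ∈ lastFallPaths n A l ↔ q ∈ truncatedPaths (n - 1) (A - l) l := by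
  rw [mem_lastFallPaths_append (by simp), truncatedPaths, Set.mem_ofPred_eq, List.append_cons,
    isMotzkin_append_fall, isMotzkin_append_fall, ← List.append_cons, nonneg_append, height_append]
  by_cases hq : height q = l
  · rw [area_insert_H hq]
    simp only [hq, nonneg_cons, nonneg_nil, height_cons, show height [] = 0 from rfl, Move.dy]
    simp
    intro _
    refine and_congr (by omega) ?_
    constructor <;> intro h <;> linarith
  · simp [hq, height_cons, show height [] = 0 from rfl, Move.dy]

theorem insert_U_mem {n A : ℤ} {l : ℕ} {q : List Move} :
    q ++ .U :: fall (l + 1) ∈ lastFallPaths n A (l + 1 : ℕ) ↔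
      q ∈ truncatedPaths (n - 2) (A - (2 * l + 1)) l := by
  rw [mem_lastFallPaths_append (by simp), truncatedPaths, Set.mem_ofPred_eq, List.append_cons,
    isMotzkin_append_fall, isMotzkin_append_fall, ← List.append_cons, nonneg_append, height_append]
  by_cases hq : height q = l
  · rw [area_insert_U hq]
    simp only [hq, nonneg_cons, nonneg_nil, height_cons, show height [] = 0 from rfl, Move.dy]
    simp
    have : (0 : ℤ) ≤ l + 1 := by positivity
    simp only [this, and_true]
    refine and_congr Iff.rfl (and_congr (by omega) ?_)
    constructor <;> intro h <;> linarith
  · simp [hq, height_cons, show height [] = 0 from rfl, Move.dy]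

/-- A Motzkin path consisting of `D` moves alone is empty, which `1 ≤ n` excludes. -/
theorem exists_of_mem_lastFallPaths {n A : ℤ} (hn : 1 ≤ n) {l : ℕ} {p : List Move}
    (hp : p ∈ lastFallPaths n A l) : ∃ q x, x ≠ Move.D ∧ p = q ++ x :: fall l := by
  obtain ⟨h1, h2, h3, h4⟩ := hp
  obtain ⟨q, hq, rfl | ⟨r, x, hx, rfl⟩⟩ := exists_eq_append_fall p
  · rw [hq, isMotzkin_append_fall] at h1
    have := h1.2
    simp [height] at this
    rw [show lastFall p = 0 by omega] at hq
    simp at hq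
    subst hq
    simp at h2
    omega
  · refine ⟨r, x, hx, ?_⟩
    rw [List.append_cons, ← Int.natCast_inj.1 h4]
    exact hq

theorem finsum_lastFallPaths_zero (W : List Move → ℤ) {n : ℤ} (hn : 1 ≤ n) (A : ℤ) :
    ∑ᶠ p ∈ lastFallPaths n A 0, W p =
      ∑ᶠ q ∈ truncatedPaths (n - 1) A 0, W (q ++ [.H]) := by
  rw [← finsum_mem_image (g := fun q => q ++ [Move.H]) (f := W)
    (fun a _ b _ hab => List.append_cancel_right hab)]
  refine finsum_mem_congr (Set.ext fun p => ?_) fun _ _ => by simp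
  have key (q) := insert_H_mem (n := n) (A := A) (l := 0) (q := q)
  simp only [Nat.cast_zero, sub_zero, fall, List.replicate_zero] at key
  simp only [Set.mem_image]
  constructor
  · intro hp
    obtain ⟨q, x, hx, rfl⟩ := exists_of_mem_lastFallPaths hn (l := 0) (by exact_mod_cast hp)
    cases x
    -- A final `U` ending on the axis would start below it.
    · have h1 := hp.1
      rw [isMotzkin_iff, nonneg_append, height_append] at h1
      have h2 := h1.1.1 q List.prefix_rfl
      have h3 := h1.2
      simp [height, Move.dy] at h2 h3
      omega
    · exact ⟨q, (key q).1 hp, rfl⟩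
    · exact absurd rfl hx
  · rintro ⟨q, hq, rfl⟩
    exact (key q).2 hq

theorem finsum_lastFallPaths_succ (W : List Move → ℤ) {n : ℤ} (hn : 1 ≤ n) (A : ℤ) (l : ℕ) :
    ∑ᶠ p ∈ lastFallPaths n A (l + 1 : ℕ), W p =
      ∑ᶠ q ∈ truncatedPaths (n - 1) (A - (l + 1 : ℕ)) (l + 1), W (q ++ .H :: fall (l + 1)) +
      ∑ᶠ q ∈ truncatedPaths (n - 2) (A - (2 * l + 1)) l, W (q ++ .U :: fall (l + 1)) := by
  rw [← finsum_mem_image (g := fun q => q ++ .H :: fall (l + 1)) (f := W)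
    (fun a _ b _ hab => List.append_cancel_right hab),
    ← finsum_mem_image (g := fun q => q ++ .U :: fall (l + 1)) (f := W)
    (fun a _ b _ hab => List.append_cancel_right hab), ← finsum_mem_union]
  · refine finsum_mem_congr (Set.ext fun p => ?_) fun _ _ => rfl
    simp only [Set.mem_image, Set.mem_union]
    constructor
    · intro hp
      obtain ⟨q, x, hx, rfl⟩ := exists_of_mem_lastFallPaths hn hp
      cases x
      · exact Or.inr ⟨q, insert_U_mem.1 hp, rfl⟩
      · exact Or.inl ⟨q, insert_H_mem.1 hp, rfl⟩
      · exact absurd rfl hx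
    · rintro (⟨q, hq, rfl⟩ | ⟨q, hq, rfl⟩)
      · exact insert_H_mem.2 hq
      · exact insert_U_mem.2 hq
  · rw [Set.disjoint_left]
    rintro _ ⟨q, -, rfl⟩ ⟨r, -, hr⟩
    have := (List.append_inj' hr (by simp)).2
    simp at this
  · exact (finite_truncatedPaths _ _ _).image _
  · exact (finite_truncatedPaths _ _ _).image _

/-- The recurrence by the last fall, for a weight of paths that is multiplied by `a l` when a move
`H` and by `b l` when a move `U` and a move `D` are inserted at height `l` before the last fall. -/
theorem finsum_lastFallPaths (W : List Move → ℤ) (a b : ℕ → ℤ)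
    (hH : ∀ q l, height q = (l : ℕ) → W (q ++ .H :: fall l) = a l * W (q ++ fall l))
    (hU : ∀ q l, height q = (l : ℕ) → W (q ++ .U :: fall (l + 1)) = b (l + 1) * W (q ++ fall l))
    {n A : ℤ} {l : ℕ} (hn : 1 ≤ n) (hb : b 0 = 0) :
    ∑ᶠ p ∈ lastFallPaths n A l, W p =
      a l * (∑ k ∈ Finset.Icc (l : ℤ) (n / 2), ∑ᶠ p ∈ lastFallPaths (n - 1) (A - l) k, W p) +
      b l * (∑ k ∈ Finset.Icc ((l : ℤ) - 1) (n / 2),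
        ∑ᶠ p ∈ lastFallPaths (n - 2) (A - (2 * l - 1)) k, W p) := by
  have key (n A : ℤ) (l : ℕ) (q) (hq : q ∈ truncatedPaths n A l) : height q = l :=
    (isMotzkin_append_fall.1 hq.1).2
  rw [sum_lastFallPaths W (by omega)]
  rcases l with _ | l
  -- For `l = 0` no `U` can be removed; the second sum, which then starts at `-1`, is cancelled by
  -- `b 0 = 0`.
  · rw [hb, zero_mul, add_zero, Nat.cast_zero, finsum_lastFallPaths_zero W hn, sub_zero,
      mul_finsum_mem' _ _ (finite_truncatedPaths _ _ _)]
    exact finsum_mem_congr rfl fun q hq => hH q 0 (key _ _ _ _ hq)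
  · have e1 : ((l + 1 : ℕ) : ℤ) - 1 = l := by push_cast; ring
    have e2 : 2 * ((l + 1 : ℕ) : ℤ) - 1 = 2 * l + 1 := by push_cast; ring
    rw [e1, e2, sum_lastFallPaths W (by omega), finsum_lastFallPaths_succ W hn,
      mul_finsum_mem' _ _ (finite_truncatedPaths _ _ _),
      mul_finsum_mem' _ _ (finite_truncatedPaths _ _ _)]
    congr 1
    · exact finsum_mem_congr rfl fun q hq => hH q _ (key _ _ _ _ hq)
    · exact finsum_mem_congr rfl fun q hq => hU q _ (key _ _ _ _ hq)

theorem lastFallCount_eq_finsum (n A l : ℤ) :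
    (lastFallCount n A l : ℤ) = ∑ᶠ p ∈ lastFallPaths n A l, (1 : ℤ) := by
  rw [finsum_mem_eq_finite_toFinset_sum _ (finite_lastFallPaths n A l), lastFallCount,
    Set.ncard_eq_toFinset_card _ (finite_lastFallPaths n A l)]
  simp

theorem lastFallCount_recurrence {n A l : ℤ} (hn : 1 ≤ n) (hl : 0 ≤ l) :
    lastFallCount n A l =
      (∑ k ∈ Finset.Icc l (n / 2), lastFallCount (n - 1) (A - l) k) +
      (if l = 0 then 0 else
        ∑ k ∈ Finset.Icc (l - 1) (n / 2), lastFallCount (n - 2) (A - (2 * l - 1)) k) := by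
  lift l to ℕ using hl
  have := finsum_lastFallPaths (fun _ => 1) (fun _ => 1) (fun l => if l = 0 then 0 else 1)
    (by simp) (by simp) (n := n) (A := A) (l := l) hn rfl
  zify
  simp only [lastFallCount_eq_finsum, this]
  split_ifs <;> simp_all

theorem lastFallWeight_recurrence {n d l : ℤ} (hn : 1 ≤ n) (hl : 0 ≤ l) :
    lastFallWeight n d l =
      (2 * l + 1) * (∑ k ∈ Finset.Icc l (n / 2), lastFallWeight (n - 1) (d - l) k) +
      l ^ 2 * (∑ k ∈ Finset.Icc (l - 1) (n / 2),
        lastFallWeight (n - 2) (d - (2 * l - 1)) k) := by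
  lift l to ℕ using hl
  exact finsum_lastFallPaths weight (fun l => 2 * l + 1) (fun l => l ^ 2)
    (fun q l hq => weight_insert_H hq)
    (fun q l hq => by rw [weight_insert_U hq]; push_cast; rfl) hn (by simp)

theorem lastFallPaths_of_nonpos {n : ℤ} (hn : n ≤ 0) (A l : ℤ) :
    lastFallPaths n A l = if n = 0 ∧ A = 0 ∧ l = 0 then {[]} else ∅ := by
  have h0 : IsMotzkin [] := by simp [IsMotzkin, height]
  ext p
  rcases p with _ | ⟨x, p⟩
  · simp only [lastFallPaths, Set.mem_ofPred_eq, h0, area, areaFrom, lastFall, true_and]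
    split_ifs with hc
    · simp [hc]
    · simp only [Set.mem_empty_iff_false, iff_false]
      rintro ⟨h1, h2, h3⟩
      exact hc ⟨by simpa using h1.symm, by exact_mod_cast h2.symm, by simpa using h3.symm⟩
  · have : ¬ ((x :: p : List Move).length : ℤ) = n := by simp; omega
    simp only [lastFallPaths, Set.mem_ofPred_eq, this, false_and, and_false, false_iff]
    split_ifs <;> simp

theorem lastFallCount_of_nonpos {n : ℤ} (hn : n ≤ 0) (A l : ℤ) :
    lastFallCount n A l = if n = 0 ∧ A = 0 ∧ l = 0 then 1 else 0 := by
  rw [lastFallCount, lastFallPaths_of_nonpos hn]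
  split_ifs <;> simp

theorem lastFallWeight_of_nonpos {n : ℤ} (hn : n ≤ 0) (d l : ℤ) :
    lastFallWeight n d l = if n = 0 ∧ d = 0 ∧ l = 0 then 1 else 0 := by
  rw [lastFallWeight, lastFallPaths_of_nonpos hn]
  split_ifs <;> simp [weight, weightFrom]

theorem sum_descents_eq_sum_lastFall (W : List Move → ℤ) (n A : ℕ) :
    ∑ p ∈ descents n 0 A, W p =
      ∑ l ∈ Finset.Icc (0 : ℤ) n, ∑ᶠ p ∈ lastFallPaths n A l, W p := by
  have := sum_lastFallPaths W (n := n) (m := n) (by omega) A 0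
  rw [Nat.cast_zero] at this
  rw [this, ← finsum_mem_coe_finset]
  refine finsum_mem_congr (Set.ext fun p => ?_) fun _ _ => by simp [fall]
  simp [mem_descents_zero, truncatedPaths, fall]

theorem motzkinCount_eq_sum (n A : ℕ) :
    motzkinCount n A = ∑ l ∈ Finset.Icc (0 : ℤ) n, lastFallCount n A l := by
  have := sum_descents_eq_sum_lastFall (fun _ => 1) n A
  zify
  simp only [lastFallCount_eq_finsum, ← this]
  simp [motzkinCount_eq_card]

/-! ## Rook placements and the displacement of permutations -/

open Classical in
/-- The placements of non-attacking rooks on an `a × b` board. -/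
noncomputable def rooks (a b : ℕ) : Finset (Finset (ℕ × ℕ)) :=
  (Finset.range a ×ˢ Finset.range b).powerset.filter fun R =>
    Set.InjOn Prod.fst (R : Set (ℕ × ℕ)) ∧ Set.InjOn Prod.snd (R : Set (ℕ × ℕ))

theorem mem_rooks {a b : ℕ} {R : Finset (ℕ × ℕ)} :
    R ∈ rooks a b ↔ (∀ p ∈ R, p.1 < a ∧ p.2 < b) ∧ (∀ p ∈ R, ∀ q ∈ R, p.1 = q.1 → p = q) ∧
      ∀ p ∈ R, ∀ q ∈ R, p.2 = q.2 → p = q := by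
  simp only [rooks, Finset.mem_filter, Finset.mem_powerset, Finset.subset_iff, Finset.mem_product,
    Finset.mem_range, Set.InjOn, Finset.mem_coe]

/-- The rows of the board without a rook. -/
def freeRows (a : ℕ) (R : Finset (ℕ × ℕ)) : Finset ℕ := Finset.range a \ R.image Prod.fst

theorem mem_freeRows {a i : ℕ} {R : Finset (ℕ × ℕ)} :
    i ∈ freeRows a R ↔ i < a ∧ ∀ p ∈ R, p.1 ≠ i := by
  simp [freeRows]; aesop

theorem card_freeRows {a b : ℕ} {R : Finset (ℕ × ℕ)} (hR : R ∈ rooks a b) :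
    (freeRows a R).card + R.card = a := by
  rw [mem_rooks] at hR
  have h1 : (R.image Prod.fst).card = R.card :=
    Finset.card_image_of_injOn fun p hp q hq => hR.2.1 p hp q hq
  have h2 : R.image Prod.fst ⊆ Finset.range a := by
    intro i hi
    obtain ⟨p, hp, rfl⟩ := Finset.mem_image.1 hi
    exact Finset.mem_range.2 (hR.1 p hp).1
  rw [freeRows, ← h1, Finset.card_sdiff_add_card_eq_card h2, Finset.card_range]

/-- The new column is either empty or has one rook, in any row still free. -/
theorem sum_rooks_add_column (a b : ℕ) (F : Finset (ℕ × ℕ) → ℕ) :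
    ∑ R ∈ rooks a (b + 1), F R =
      ∑ R ∈ rooks a b, (F R + ∑ i ∈ freeRows a R, F (insert (i, b) R)) := by
  classical
  rw [Finset.sum_add_distrib,
    ← Finset.sum_filter_add_sum_filter_not (rooks a (b + 1)) (fun R => ∀ p ∈ R, p.2 ≠ b)]
  congr 1
  · refine Finset.sum_congr ?_ fun _ _ => rfl
    ext R
    simp only [Finset.mem_filter, mem_rooks]
    constructor
    · rintro ⟨⟨h1, h2⟩, h3⟩
      exact ⟨fun p hp => ⟨(h1 p hp).1, by have := (h1 p hp).2; have := h3 p hp; omega⟩, h2⟩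
    · rintro ⟨h1, h2⟩
      exact ⟨⟨fun p hp => ⟨(h1 p hp).1, by have := (h1 p hp).2; omega⟩, h2⟩,
        fun p hp => by have := (h1 p hp).2; omega⟩
  · rw [Finset.sum_sigma']
    symm
    refine Finset.sum_nbij (fun x => insert (x.2, b) x.1) ?_ ?_ ?_ (fun _ _ => rfl)
    · rintro ⟨R, i⟩ hx
      simp only [Finset.mem_sigma, mem_freeRows, mem_rooks] at hx
      obtain ⟨⟨h1, h2, h3⟩, h4, h5⟩ := hx
      simp only [Finset.mem_filter, mem_rooks, Finset.forall_mem_insert]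
      refine ⟨⟨⟨⟨h4, by omega⟩, fun p hp => ⟨(h1 p hp).1, by have := (h1 p hp).2; omega⟩⟩,
        ⟨⟨fun _ => trivial, fun p hp e => absurd e.symm (h5 p hp)⟩,
          fun p hp => ⟨fun e => absurd e (h5 p hp), h2 p hp⟩⟩,
        ⟨⟨fun _ => trivial, fun p hp e => ?_⟩, fun p hp => ⟨fun e => ?_, h3 p hp⟩⟩⟩, by simp⟩
      · have := (h1 p hp).2; omega
      · have := (h1 p hp).2; omega
    · rintro ⟨R, i⟩ hx ⟨S, j⟩ hy h
      simp only [Finset.coe_sigma, Set.mem_sigma_iff, Finset.mem_coe, mem_rooks] at hx hy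
      have hR : ∀ t, (t, b) ∉ R := fun t ht => by have := (hx.1.1 _ ht).2; simp at this
      have hS : ∀ t, (t, b) ∉ S := fun t ht => by have := (hy.1.1 _ ht).2; simp at this
      simp only at h
      have hij : i = j := by
        have : (i, b) ∈ insert (j, b) S := h ▸ Finset.mem_insert_self _ _
        rcases Finset.mem_insert.1 this with e | e
        · exact congrArg Prod.fst e
        · exact absurd e (hS i)
      subst hij
      have : R = S := by
        rw [← Finset.erase_insert (hR i), h, Finset.erase_insert (hS i)]
      subst this; rfl
    · intro R hR
      simp only [Finset.mem_coe, Finset.mem_filter, mem_rooks] at hR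
      obtain ⟨⟨h1, h2, h3⟩, h4⟩ := hR
      push Not at h4
      obtain ⟨⟨i, j⟩, hp, rfl⟩ := h4
      refine ⟨⟨R.erase (i, j), i⟩, ?_, Finset.insert_erase hp⟩
      simp only [Finset.coe_sigma, Set.mem_sigma_iff, Finset.mem_coe, mem_rooks, mem_freeRows]
      refine ⟨⟨fun p hq => ?_, fun p hp q hq => h2 p (Finset.mem_of_mem_erase hp) q
        (Finset.mem_of_mem_erase hq), fun p hp q hq => h3 p (Finset.mem_of_mem_erase hp) q
        (Finset.mem_of_mem_erase hq)⟩, (h1 _ hp).1, fun p hq e => ?_⟩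
      · obtain ⟨hne, hq⟩ := Finset.mem_erase.1 hq
        have := (h1 p hq).2
        refine ⟨(h1 p hq).1, ?_⟩
        have : p.2 ≠ j := fun e => hne (h3 p hq _ hp e)
        simp at *; omega
      · obtain ⟨hne, hq⟩ := Finset.mem_erase.1 hq
        exact hne (h2 p hq _ hp e)

/-- The transposed placement. -/
def transpose (R : Finset (ℕ × ℕ)) : Finset (ℕ × ℕ) := R.image Prod.swap

theorem transpose_transpose (R : Finset (ℕ × ℕ)) : transpose (transpose R) = R := by
  simp [transpose, Finset.image_image]

theorem transpose_mem {a b : ℕ} {R : Finset (ℕ × ℕ)} (hR : R ∈ rooks a b) :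
    transpose R ∈ rooks b a := by
  rw [mem_rooks] at *
  simp only [transpose, Finset.forall_mem_image]
  refine ⟨fun p hp => (hR.1 p hp).symm, fun p hp q hq e => ?_, fun p hp q hq e => ?_⟩
  · rw [hR.2.2 p hp q hq e]
  · rw [hR.2.1 p hp q hq e]

theorem card_transpose (R : Finset (ℕ × ℕ)) : (transpose R).card = R.card :=
  Finset.card_image_of_injective _ Prod.swap_injective

theorem sum_rooks_transpose (a b : ℕ) (F : Finset (ℕ × ℕ) → ℕ) :
    ∑ R ∈ rooks a b, F R = ∑ R ∈ rooks b a, F (transpose R) :=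
  Finset.sum_nbij' transpose transpose (fun _ h => transpose_mem h) (fun _ h => transpose_mem h)
    (fun R _ => transpose_transpose R) (fun R _ => transpose_transpose R)
    (fun R _ => by rw [transpose_transpose])

theorem sum_rooks_add_row (a b : ℕ) (F : Finset (ℕ × ℕ) → ℕ) :
    ∑ R ∈ rooks (a + 1) b, F R =
      ∑ R ∈ rooks a b, (F R + ∑ j ∈ freeRows b (transpose R), F (insert (a, j) R)) := by
  rw [sum_rooks_transpose, sum_rooks_add_column, sum_rooks_transpose]
  refine Finset.sum_congr rfl fun R _ => ?_
  rw [transpose_transpose]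
  congr 1
  refine Finset.sum_congr rfl fun j _ => ?_
  congr 1
  conv_rhs => rw [← transpose_transpose R]
  simp [transpose, Finset.image_insert]

/-- The rooks in the upper left `k × k` square. -/
def corner (k : ℕ) (R : Finset (ℕ × ℕ)) : Finset (ℕ × ℕ) := R.filter fun p => p.1 < k ∧ p.2 < k

theorem corner_insert {k : ℕ} {p : ℕ × ℕ} (hp : ¬ (p.1 < k ∧ p.2 < k)) (R : Finset (ℕ × ℕ)) :
    corner k (insert p R) = corner k R := by
  rw [corner, Finset.filter_insert, if_neg hp, corner]

theorem corner_eq_self {k : ℕ} {R : Finset (ℕ × ℕ)} (hR : R ∈ rooks k k) : corner k R = R :=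
  Finset.filter_true_of_mem (mem_rooks.1 hR).1

theorem corner_corner {j k : ℕ} (hj : j ≤ k) (R : Finset (ℕ × ℕ)) :
    corner j (corner k R) = corner j R := by
  ext p; simp only [corner, Finset.mem_filter]
  constructor
  · tauto
  · rintro ⟨h1, h2, h3⟩; exact ⟨⟨h1, by omega, by omega⟩, h2, h3⟩

/-- With `g` free rows there are also `g` free columns. A single new rook goes to the new corner
cell or to one of `g + g` cells of the new row and column; two new rooks occupy one cell of each,
off the corner. -/
theorem sum_rooks_succ (k : ℕ) (G : Finset (ℕ × ℕ) → ℕ → ℕ) :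
    ∑ R ∈ rooks (k + 1) (k + 1), G (corner k R) R.card =
      ∑ R ∈ rooks k k, (G R R.card + (2 * (k - R.card) + 1) * G R (R.card + 1) +
        (k - R.card) ^ 2 * G R (R.card + 2)) := by
  have h1 : ∀ R ∈ rooks k (k + 1), G (corner k R) R.card + ∑ j ∈ freeRows (k + 1) (transpose R),
      G (corner k (insert (k, j) R)) (insert (k, j) R).card =
      G (corner k R) R.card + (k + 1 - R.card) * G (corner k R) (R.card + 1) := by
    intro R hR
    have hc := card_freeRows (transpose_mem hR)
    rw [card_transpose] at hc
    congr 1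
    rw [Finset.sum_congr rfl (g := fun _ => G (corner k R) (R.card + 1))]
    · rw [Finset.sum_const, smul_eq_mul]; congr 1; omega
    · intro j _
      rw [corner_insert (by simp), Finset.card_insert_of_notMem]
      intro hm
      have := ((mem_rooks.1 hR).1 _ hm).1
      simp at this
  rw [sum_rooks_add_row, Finset.sum_congr rfl h1,
    sum_rooks_add_column k k
      fun R => G (corner k R) R.card + (k + 1 - R.card) * G (corner k R) (R.card + 1)]
  refine Finset.sum_congr rfl fun R hR => ?_
  have hc := card_freeRows hR
  rw [Finset.sum_congr rfl (g := fun _ => G R (R.card + 1) + (k - R.card) * G R (R.card + 2))]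
  · rw [Finset.sum_const, smul_eq_mul, corner_eq_self hR]
    obtain ⟨g, hg⟩ : ∃ g, g = (freeRows k R).card := ⟨_, rfl⟩
    rw [← hg] at hc ⊢
    rw [show k - R.card = g by omega, show k + 1 - R.card = g + 1 by omega]
    ring
  · intro i _
    rw [corner_insert (by simp), Finset.card_insert_of_notMem, corner_eq_self hR,
      show k + 1 - (R.card + 1) = k - R.card by omega]
    intro hm
    have := ((mem_rooks.1 hR).1 _ hm).2
    simp at this

/-- The sum over the upper left squares of the numbers of their rows without a rook in them. -/
def freeSum (k : ℕ) (R : Finset (ℕ × ℕ)) : ℕ :=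
  ∑ j ∈ Finset.range k, (j + 1 - (corner (j + 1) R).card)

theorem freeSum_succ {k : ℕ} {R : Finset (ℕ × ℕ)} (hR : R ∈ rooks (k + 1) (k + 1)) :
    freeSum (k + 1) R = freeSum k (corner k R) + (k + 1 - R.card) := by
  rw [freeSum, Finset.sum_range_succ, corner_eq_self hR, freeSum]
  congr 1
  refine Finset.sum_congr rfl fun j hj => ?_
  rw [corner_corner]
  have := Finset.mem_range.1 hj
  omega

/-- The number of placements on a `k × k` board with `h` free rows and `freeSum` equal to `s`. -/
noncomputable def rookCount (k h s : ℕ) : ℕ :=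
  ∑ R ∈ rooks k k, if R.card + h = k ∧ freeSum k R = s then 1 else 0

theorem rookCount_zero (h s : ℕ) : rookCount 0 h s = if h = 0 ∧ s = 0 then 1 else 0 := by
  have : rooks 0 0 = {∅} := by
    ext R
    rw [mem_rooks, Finset.mem_singleton]
    constructor
    · intro hR
      refine Finset.eq_empty_of_forall_notMem fun p hp => ?_
      have := (hR.1 p hp).1
      omega
    · rintro rfl; simp
  rw [rookCount, this, Finset.sum_singleton]
  simp [freeSum, eq_comm]

/-- Reaching `h` free rows by adding two, one or no rooks requires `h + 1`, `h` or `h - 1` free rows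
before. The enlarged board contributes its own `h` to `freeSum`. -/
theorem rookCount_succ (k h s : ℕ) :
    rookCount (k + 1) h s =
      if h ≤ s then
        (h + 1) ^ 2 * rookCount k (h + 1) (s - h) + (2 * h + 1) * rookCount k h (s - h) +
          if h = 0 then 0 else rookCount k (h - 1) (s - h)
      else 0 := by
  have h1 : rookCount (k + 1) h s = ∑ R ∈ rooks (k + 1) (k + 1),
      if R.card + h = k + 1 ∧ freeSum k (corner k R) + (k + 1 - R.card) = s then 1 else 0 := by
    refine Finset.sum_congr rfl fun R hR => ?_
    rw [freeSum_succ hR]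
  rw [h1, sum_rooks_succ k fun S c =>
    if c + h = k + 1 ∧ freeSum k S + (k + 1 - c) = s then 1 else 0]
  split_ifs with hs hz
  · subst hz
    rw [add_zero, rookCount, rookCount, Finset.mul_sum, Finset.mul_sum, ← Finset.sum_add_distrib]
    refine Finset.sum_congr rfl fun R hR => ?_
    have hc := card_freeRows hR
    generalize freeSum k R = x
    simp only [add_zero]
    have e1 : ¬ (R.card = k + 1 ∧ x + (k + 1 - R.card) = s) := by omega
    have e2 : (R.card + 1 = k + 1 ∧ x + (k + 1 - (R.card + 1)) = s) ↔
      (R.card = k ∧ x = s - 0) := by omega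
    have e3 : (R.card + 2 = k + 1 ∧ x + (k + 1 - (R.card + 2)) = s) ↔
      (R.card + (0 + 1) = k ∧ x = s - 0) := by omega
    simp only [e1, e2, e3, if_false]
    split_ifs with c1 c2
    · omega
    · rw [c1.1]; simp
    · rw [show k - R.card = 1 by omega]; simp
    · simp
  · rw [rookCount, rookCount, rookCount, Finset.mul_sum, Finset.mul_sum, ← Finset.sum_add_distrib,
      ← Finset.sum_add_distrib]
    refine Finset.sum_congr rfl fun R hR => ?_
    have hc := card_freeRows hR
    generalize freeSum k R = x
    have e1 : (R.card + h = k + 1 ∧ x + (k + 1 - R.card) = s) ↔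
      (R.card + (h - 1) = k ∧ x = s - h) := by omega
    have e2 : (R.card + 1 + h = k + 1 ∧ x + (k + 1 - (R.card + 1)) = s) ↔
      (R.card + h = k ∧ x = s - h) := by omega
    have e3 : (R.card + 2 + h = k + 1 ∧ x + (k + 1 - (R.card + 2)) = s) ↔
      (R.card + (h + 1) = k ∧ x = s - h) := by omega
    simp only [e1, e2, e3]
    split_ifs with c1 c2 c3 c2 c3
    all_goals first
      | omega
      | (rw [show k - R.card = h + 1 by omega]; simp)
  · refine Finset.sum_eq_zero fun R hR => ?_
    have hc := card_freeRows hR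
    rw [if_neg (by omega), if_neg (by omega), if_neg (by omega)]
    simp

/-- The factorial splits the factor `(h + 1) ^ 2`, which sits on one kind of step only, evenly
between the steps up and down. -/
theorem factorial_mul_rookCount (k h s : ℕ) :
    h.factorial * rookCount k h s =
      transfer (fun h => h + 1) (fun h => 2 * h + 1) (fun h => h) k h s := by
  induction k generalizing h s with
  | zero =>
    rw [rookCount_zero, transfer]
    split_ifs with hc
    · simp [hc.1]
    · simp
  | succ k ih =>
    rw [rookCount_succ, transfer]
    split_ifs with hs hz
    · subst hz
      rw [← ih, ← ih]; simp
    · obtain ⟨g, rfl⟩ := Nat.exists_eq_succ_of_ne_zero hz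
      rw [← ih, ← ih, ← ih]
      simp only [Nat.succ_eq_add_one, Nat.factorial_succ, Nat.add_sub_cancel]
      ring
    · simp

/-! ### Permutations as full rook placements -/

/-- The permutation matrix of a permutation, as a placement of rooks. -/
def graph {n : ℕ} (π : Equiv.Perm (Fin n)) : Finset (ℕ × ℕ) :=
  Finset.univ.image fun i : Fin n => ((i : ℕ), ((π i : Fin n) : ℕ))

theorem graph_mem_rooks {n : ℕ} (π : Equiv.Perm (Fin n)) : graph π ∈ rooks n n := by
  rw [mem_rooks]
  simp only [graph, Finset.forall_mem_image]
  refine ⟨fun i _ => ⟨i.2, (π i).2⟩, fun i _ j _ e => ?_, fun i _ j _ e => ?_⟩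
  · rw [Fin.ext e]
  · rw [π.injective (Fin.ext e)]

theorem injective_pair {n : ℕ} (f : Fin n → ℕ) :
    Function.Injective fun i : Fin n => ((i : ℕ), f i) :=
  fun _ _ h => Fin.ext (congrArg Prod.fst h)

theorem card_graph {n : ℕ} (π : Equiv.Perm (Fin n)) : (graph π).card = n := by
  rw [graph, Finset.card_image_of_injective _ (injective_pair _), Finset.card_univ,
    Fintype.card_fin]

theorem graph_injective {n : ℕ} : Function.Injective (graph (n := n)) := by
  intro π σ h
  ext i
  have : ((i : ℕ), ((π i : Fin n) : ℕ)) ∈ graph σ :=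
    h ▸ Finset.mem_image_of_mem _ (Finset.mem_univ i)
  obtain ⟨j, -, hj⟩ := Finset.mem_image.1 this
  simp only [Prod.mk.injEq] at hj
  obtain rfl := Fin.ext hj.1
  exact hj.2.symm

theorem exists_graph_eq {n : ℕ} {R : Finset (ℕ × ℕ)} (hR : R ∈ rooks n n) (hc : R.card = n) :
    ∃ π : Equiv.Perm (Fin n), graph π = R := by
  have hfree : freeRows n R = ∅ := by
    have := card_freeRows hR
    exact Finset.card_eq_zero.1 (by omega)
  rw [mem_rooks] at hR
  have hex : ∀ i : Fin n, ∃ j : Fin n, ((i : ℕ), (j : ℕ)) ∈ R := by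
    intro i
    have hi : (i : ℕ) ∉ freeRows n R := by simp [hfree]
    rw [mem_freeRows] at hi
    push Not at hi
    obtain ⟨p, hp, e⟩ := hi i.2
    exact ⟨⟨p.2, (hR.1 p hp).2⟩, by rw [← e]; exact hp⟩
  choose f hf using hex
  have hinj : Function.Injective f := fun i j e =>
    Fin.ext (congrArg Prod.fst (hR.2.2 _ (hf i) _ (hf j) (congrArg Fin.val e)))
  refine ⟨Equiv.ofBijective f (Finite.injective_iff_bijective.1 hinj), ?_⟩
  refine Finset.eq_of_subset_of_card_le ?_ (by rw [card_graph, hc])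
  intro p hp
  obtain ⟨i, -, rfl⟩ := Finset.mem_image.1 hp
  exact hf i

/-- The distance counts the thresholds `j` that separate `a` from `b`. -/
theorem abs_sub_eq_sum {n a b : ℕ} (ha : a < n) (hb : b < n) :
    |(a : ℤ) - b| = ∑ j ∈ Finset.range n,
      ((if a ≤ j ∧ ¬ b ≤ j then 1 else 0) + if b ≤ j ∧ ¬ a ≤ j then 1 else 0) := by
  have key (a b : ℕ) (hb : b < n) :
      ∑ j ∈ Finset.range n, (if a ≤ j ∧ ¬ b ≤ j then (1 : ℤ) else 0) = (b - a : ℕ) := by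
    rw [← Nat.card_Ico, Finset.sum_boole]
    congr 2
    ext j; simp; omega
  rw [Finset.sum_add_distrib, key a b hb, key b a ha]
  rcases le_total a b with h | h
  · rw [abs_of_nonpos (by omega)]; omega
  · rw [abs_of_nonneg (by omega)]; omega

theorem card_le_fin {n j : ℕ} (hj : j < n) :
    ∑ i : Fin n, (if (i : ℕ) ≤ j then (1 : ℤ) else 0) = j + 1 := by
  rw [Fin.sum_univ_eq_sum_range (fun i => if i ≤ j then (1 : ℤ) else 0), Finset.sum_boole]
  have : (Finset.range n).filter (fun i => i ≤ j) = Finset.range (j + 1) := by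
    ext i; simp; omega
  rw [this]; simp

/-- After exchanging the sums, fix a cut `j`: the `j + 1` small rows and the `j + 1` small columns
share the rooks of the corner, so the crossings in both directions are equally many. -/
theorem displacement_eq {n : ℕ} (π : Equiv.Perm (Fin n)) :
    displacement π = 2 * (freeSum n (graph π) : ℤ) := by
  have h1 : displacement π = ∑ i : Fin n, ∑ j ∈ Finset.range n,
      ((if (i : ℕ) ≤ j ∧ ¬ (π i : ℕ) ≤ j then (1 : ℤ) else 0) +
        if (π i : ℕ) ≤ j ∧ ¬ (i : ℕ) ≤ j then 1 else 0) :=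
    Finset.sum_congr rfl fun i _ => abs_sub_eq_sum i.2 (π i).2
  rw [h1, Finset.sum_comm, freeSum, Nat.cast_sum, Finset.mul_sum]
  refine Finset.sum_congr rfl fun j hj => ?_
  have hj := Finset.mem_range.1 hj
  set c : ℤ := ∑ i : Fin n, if (i : ℕ) ≤ j ∧ (π i : ℕ) ≤ j then 1 else 0 with hc
  have hcorner : ((corner (j + 1) (graph π)).card : ℤ) = c := by
    rw [corner, graph, Finset.filter_image, Finset.card_image_of_injective _ (injective_pair _), hc,
      Finset.sum_boole]
    simp
  have e1 : ∑ i : Fin n, (if (i : ℕ) ≤ j ∧ ¬ (π i : ℕ) ≤ j then (1 : ℤ) else 0) + c = j + 1 := by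
    rw [hc, ← Finset.sum_add_distrib, ← card_le_fin hj]
    refine Finset.sum_congr rfl fun i _ => ?_
    split_ifs <;> simp_all
  have e2 : ∑ i : Fin n, (if (π i : ℕ) ≤ j ∧ ¬ (i : ℕ) ≤ j then (1 : ℤ) else 0) + c = j + 1 := by
    rw [hc, ← Finset.sum_add_distrib, ← card_le_fin hj,
      ← Equiv.sum_comp π fun i : Fin n => if (i : ℕ) ≤ j then (1 : ℤ) else 0]
    refine Finset.sum_congr rfl fun i _ => ?_
    split_ifs <;> simp_all
  -- This makes the truncated subtraction in `freeSum` a true one.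
  have e3 : 0 ≤ ∑ i : Fin n, (if (i : ℕ) ≤ j ∧ ¬ (π i : ℕ) ≤ j then (1 : ℤ) else 0) :=
    Finset.sum_nonneg fun i _ => by split_ifs <;> simp
  rw [Finset.sum_add_distrib]
  omega

theorem displacementCount_eq_transfer (n d : ℕ) :
    displacementCount n d =
      transfer (fun h => h + 1) (fun h => 2 * h + 1) (fun h => h) n 0 d := by
  rw [← factorial_mul_rookCount, Nat.factorial_zero, one_mul, rookCount, Finset.sum_boole,
    displacementCount, Nat.cast_id]
  refine Finset.card_nbij graph ?_ graph_injective.injOn ?_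
  · intro π hπ
    have hπ := (Finset.mem_filter.1 hπ).2
    rw [displacement_eq] at hπ
    exact Finset.mem_filter.2 ⟨graph_mem_rooks π, card_graph π, by omega⟩
  · intro R hR
    obtain ⟨h1, h2, h3⟩ := Finset.mem_filter.1 hR
    obtain ⟨π, rfl⟩ := exists_graph_eq h1 h2
    refine ⟨π, Finset.mem_filter.2 ⟨Finset.mem_univ _, ?_⟩, rfl⟩
    rw [displacement_eq, h3]

theorem displacementCount_eq_sum (n d : ℕ) :
    (displacementCount n d : ℤ) = ∑ l ∈ Finset.Icc (0 : ℤ) n, lastFallWeight n d l := by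
  rw [displacementCount_eq_transfer, ← sum_weight_descents, sum_descents_eq_sum_lastFall]
  rfl

/-! ## The dynamic program on the random access machine -/

/-- From the state `s`, the program `P` halts within `T` steps in a state that satisfies `Q`. -/
def Wp (m w : ℕ) (P : Prog) (T : ℕ) (Q : State → Prop) (s : State) : Prop :=
  ∃ t s', t ≤ T ∧ Run m w P s t s' ∧ Q s'

theorem Wp.mono {m w : ℕ} {P : Prog} {T T' : ℕ} {Q Q' : State → Prop} {s : State}
    (h : Wp m w P T Q s) (hT : T ≤ T') (hQ : ∀ s, Q s → Q' s) : Wp m w P T' Q' s := by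
  obtain ⟨t, s', h1, h2, h3⟩ := h
  exact ⟨t, s', h1.trans hT, h2, hQ _ h3⟩

theorem wp_seq {m w : ℕ} {P P' : Prog} {T T' : ℕ} {Q : State → Prop} {s : State}
    (h : Wp m w P T (Wp m w P' T' Q) s) : Wp m w (.seq P P') (T + T') Q s := by
  obtain ⟨t, s', h1, h2, t', s'', h3, h4, h5⟩ := h
  exact ⟨t + t', s'', by omega, .seq h2 h4, h5⟩

theorem wp_arith {m w : ℕ} {o : Op} {r a b : ℕ} {Q : State → Prop} {s : State} (z : ℕ)
    (hz : o.eval (s.reg a) (s.reg b) = z) (hw : z ≤ w) (h : Q (s.setReg r z)) :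
    Wp m w (.arith o r a b) 1 Q s := by
  subst hz
  exact ⟨1, _, le_rfl, .arith s o r a b hw, h⟩

theorem wp_const {m w : ℕ} {r c : ℕ} {Q : State → Prop} {s : State} (hw : c ≤ w)
    (h : Q (s.setReg r c)) : Wp m w (.const r c) 1 Q s :=
  ⟨1, _, le_rfl, .const s r c hw, h⟩

theorem wp_move {m w : ℕ} {r a : ℕ} {Q : State → Prop} {s : State} (x : ℕ) (hx : s.reg a = x)
    (h : Q (s.setReg r x)) : Wp m w (.move r a) 1 Q s := by
  subst hx
  exact ⟨1, _, le_rfl, .move s r a, h⟩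

theorem wp_load {m w : ℕ} {r a : ℕ} {Q : State → Prop} {s : State} (x y : ℕ) (hx : s.reg a = x)
    (hy : s.mem x = y) (hm : x < m) (h : Q (s.setReg r y)) : Wp m w (.load r a) 1 Q s := by
  subst hx hy
  exact ⟨1, _, le_rfl, .load s r a hm, h⟩

theorem wp_store {m w : ℕ} {r a : ℕ} {Q : State → Prop} {s : State} (x y : ℕ) (hx : s.reg a = x)
    (hy : s.reg r = y) (hm : x < m) (h : Q (s.setMem x y)) : Wp m w (.store a r) 1 Q s := by
  subst hx hy
  exact ⟨1, _, le_rfl, .store s a r hm, h⟩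

/-- The explicit result `z` keeps states in closed form, and the budget `T + 1` lets a numeral be
consumed one step at a time. -/
theorem wp_arith_seq {m w : ℕ} {o : Op} {r a b : ℕ} {P : Prog} {T : ℕ} {Q : State → Prop}
    {s : State} (z : ℕ) (hz : o.eval (s.reg a) (s.reg b) = z) (hw : z ≤ w)
    (h : Wp m w P T Q (s.setReg r z)) :
    Wp m w (.seq (.arith o r a b) P) (T + 1) Q s :=
  Nat.add_comm 1 T ▸ wp_seq (wp_arith z hz hw h)

theorem wp_const_seq {m w : ℕ} {r c : ℕ} {P : Prog} {T : ℕ} {Q : State → Prop} {s : State}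
    (hw : c ≤ w) (h : Wp m w P T Q (s.setReg r c)) : Wp m w (.seq (.const r c) P) (T + 1) Q s :=
  Nat.add_comm 1 T ▸ wp_seq (wp_const hw h)

theorem wp_move_seq {m w : ℕ} {r a : ℕ} {P : Prog} {T : ℕ} {Q : State → Prop} {s : State} (x : ℕ)
    (hx : s.reg a = x) (h : Wp m w P T Q (s.setReg r x)) :
    Wp m w (.seq (.move r a) P) (T + 1) Q s :=
  Nat.add_comm 1 T ▸ wp_seq (wp_move x hx h)

theorem wp_load_seq {m w : ℕ} {r a : ℕ} {P : Prog} {T : ℕ} {Q : State → Prop} {s : State}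
    (x y : ℕ) (hx : s.reg a = x) (hy : s.mem x = y) (hm : x < m)
    (h : Wp m w P T Q (s.setReg r y)) : Wp m w (.seq (.load r a) P) (T + 1) Q s :=
  Nat.add_comm 1 T ▸ wp_seq (wp_load x y hx hy hm h)

theorem wp_store_seq {m w : ℕ} {r a : ℕ} {P : Prog} {T : ℕ} {Q : State → Prop} {s : State}
    (x y : ℕ) (hx : s.reg a = x) (hy : s.reg r = y) (hm : x < m)
    (h : Wp m w P T Q (s.setMem x y)) : Wp m w (.seq (.store a r) P) (T + 1) Q s :=
  Nat.add_comm 1 T ▸ wp_seq (wp_store x y hx hy hm h)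

/-- A loop that counts the register `r` down to `0`. -/
theorem wp_loop {m w r : ℕ} {P : Prog} {T : ℕ} (I : ℕ → State → Prop)
    (hr : ∀ i s, I i s → s.reg r = i) (hP : ∀ i s, I (i + 1) s → Wp m w P T (I i) s)
    (i : ℕ) (s : State) (hs : I i s) : Wp m w (.loop r P) (i * (T + 1) + 1) (I 0) s := by
  induction i generalizing s with
  | zero => exact ⟨1, s, by omega, .loopDone (hr _ _ hs), hs⟩
  | succ i ih =>
    obtain ⟨t, s', h1, h2, h3⟩ := hP i s hs
    obtain ⟨t', s'', h4, h5, h6⟩ := ih s' h3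
    refine ⟨t + 1 + t', s'', ?_, .loopStep (by rw [hr _ _ hs]; omega) h2 h5, h6⟩
    rw [Nat.succ_mul]; omega

@[simp] theorem reg_setReg (s : State) (r r' v : ℕ) :
    (s.setReg r v).reg r' = if r' = r then v else s.reg r' := by
  simp [State.setReg, Function.update_apply]

@[simp] theorem mem_setReg (s : State) (r v : ℕ) : (s.setReg r v).mem = s.mem := rfl

@[simp] theorem reg_setMem (s : State) (a v : ℕ) : (s.setMem a v).reg = s.reg := rfl

@[simp] theorem mem_setMem (s : State) (a v : ℕ) :
    (s.setMem a v).mem = Function.update s.mem a v := rfl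

/-! ### The table and the program -/

/-- The weight of a move up from height `h`: `1` for `c = 0` and `h + 1` for `c = 1`. -/
def upWeight (c h : ℕ) : ℕ := c * h + 1

/-- The weight of a horizontal move at height `h`: `1` for `c = 0` and `2 * h + 1` for `c = 1`. -/
def flatWeight (c h : ℕ) : ℕ := c * h + c * h + 1

/-- The weight of a move down from height `h > 0`: `1` for `c = 0` and `h` for `c = 1`. -/
def downWeight (c h : ℕ) : ℕ := 1 - (1 - h) + c * (h - 1)

/-- The table of the dynamic program, which the programs below update in place: layer `k` holds the
numbers of the paths of `k` moves by starting height `h` and sum `s` of the starting heights. -/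
abbrev table (c k h s : ℕ) : ℕ := transfer (upWeight c) (flatWeight c) (downWeight c) k h s

/-- Computes one entry of the table from the previous layer. The registers hold the row length `N`
in `2`, one in `3`, `c` in `4`, the area plus one in `6`, the number of remaining heights in `7`
and the height in `8`. -/
def entryProg : Prog :=
  .seq (.arith .sub 9 6 3) <|
  -- Register `10` becomes the indicator of `h ≤ i`, where `i` is the area; the result is multiplied
  -- by it in place of a branch.
  .seq (.arith .sub 10 8 9) <|
  .seq (.arith .sub 10 3 10) <|
  .seq (.arith .sub 11 9 8) <|
  .seq (.arith .mul 12 8 2) <|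
  .seq (.arith .add 11 12 11) <|
  .seq (.arith .add 12 12 9) <|
  .seq (.load 13 11) <|
  .seq (.arith .add 14 11 2) <|
  .seq (.load 14 14) <|
  .seq (.arith .sub 15 11 2) <|
  .seq (.load 15 15) <|
  .seq (.arith .mul 16 4 8) <|
  .seq (.arith .add 17 16 16) <|
  .seq (.arith .add 17 17 3) <|
  .seq (.arith .mul 13 13 17) <|
  .seq (.arith .add 16 16 3) <|
  .seq (.arith .mul 14 14 16) <|
  .seq (.arith .add 13 13 14) <|
  .seq (.arith .sub 16 3 8) <|
  .seq (.arith .sub 16 3 16) <|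
  .seq (.arith .sub 17 8 3) <|
  .seq (.arith .mul 17 4 17) <|
  .seq (.arith .add 16 16 17) <|
  .seq (.arith .mul 15 15 16) <|
  .seq (.arith .add 13 13 15) <|
  .seq (.arith .mul 13 13 10) <|
  .seq (.store 12 13) <|
  .seq (.arith .add 8 8 3) <|
  .arith .sub 7 7 3

/-- There is no branching, so even values later multiplied by 0 are read and must obey the bound
`B`. -/
theorem wp_entryProg {m w n N c i j h y₀ y₁ y₂ B : ℕ} {s : State} (hc : c ≤ 1) (hh : h ≤ n)
    (hi : i < N) (hm : (n + 2) * N ≤ m) (hw : (n + 2) * N ≤ w) (hB : 1 ≤ B)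
    (hwB : (4 * n + 4) * B ≤ w) (hy₀ : y₀ ≤ B) (hy₁ : y₁ ≤ B) (hy₂ : y₂ ≤ B)
    (h2 : s.reg 2 = N) (h3 : s.reg 3 = 1) (h4 : s.reg 4 = c) (h6 : s.reg 6 = i + 1)
    (h7 : s.reg 7 = j + 1) (h8 : s.reg 8 = h) (hj : j ≤ n)
    (m0 : s.mem (h * N + (i - h)) = y₀) (m1 : s.mem (h * N + (i - h) + N) = y₁)
    (m2 : s.mem (h * N + (i - h) - N) = y₂) :
    Wp m w entryProg 30 (fun s' => (∀ r < 7, s'.reg r = s.reg r) ∧ s'.reg 7 = j ∧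
      s'.reg 8 = h + 1 ∧ s'.mem = Function.update s.mem (h * N + i)
        ((y₀ * flatWeight c h + y₁ * upWeight c h + y₂ * downWeight c h) * (1 - (h - i)))) s := by
  simp only [flatWeight, upWeight, downWeight]
  obtain ⟨x, hx⟩ : ∃ x, x = y₀ * (c * h + c * h + 1) + y₁ * (c * h + 1) +
      y₂ * (1 - (1 - h) + c * (h - 1)) := ⟨_, rfl⟩
  rw [← hx]
  have hN : h * N + 2 * N ≤ (n + 2) * N := by
    rw [← Nat.add_mul]; exact Nat.mul_le_mul_right _ (by omega)
  have hnN : n + 2 ≤ (n + 2) * N := Nat.le_mul_of_pos_right _ (by omega)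
  have hch : c * h ≤ h := by simpa using Nat.mul_le_mul_right h hc
  have hch' : c * (h - 1) ≤ h - 1 := by simpa using Nat.mul_le_mul_right (h - 1) hc
  have hBn : 4 * n + 4 ≤ (4 * n + 4) * B := Nat.le_mul_of_pos_right _ (by omega)
  have hxw : x ≤ w := by
    refine le_trans ?_ hwB
    calc x ≤ B * (c * h + c * h + 1) + B * (c * h + 1) + B * (1 - (1 - h) + c * (h - 1)) := by
          rw [hx]; gcongr
      _ = (c * h + c * h + 1 + (c * h + 1) + (1 - (1 - h) + c * (h - 1))) * B := by ring
      _ ≤ (4 * n + 4) * B := Nat.mul_le_mul_right _ (by omega)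
  have hxw' : x * (1 - (h - i)) ≤ x := by
    simpa using Nat.mul_le_mul_left x (Nat.sub_le 1 (h - i))
  rw [entryProg]
  refine wp_arith_seq i (by simp [*, Op.eval]) (by omega) ?_
  refine wp_arith_seq (h - i) (by simp [*, Op.eval]) (by omega) ?_
  refine wp_arith_seq (1 - (h - i)) (by simp [*, Op.eval]) (by omega) ?_
  refine wp_arith_seq (i - h) (by simp [*, Op.eval]) (by omega) ?_
  refine wp_arith_seq (h * N) (by simp [*, Op.eval]) (by omega) ?_
  refine wp_arith_seq (h * N + (i - h)) (by simp [*, Op.eval]) (by omega) ?_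
  refine wp_arith_seq (h * N + i) (by simp [*, Op.eval]) (by omega) ?_
  refine wp_load_seq (h * N + (i - h)) y₀ (by simp [*]) (by simp [*]) (by omega) ?_
  refine wp_arith_seq (h * N + (i - h) + N) (by simp [*, Op.eval]) (by omega) ?_
  refine wp_load_seq (h * N + (i - h) + N) y₁ (by simp [*]) (by simp [*]) (by omega) ?_
  refine wp_arith_seq (h * N + (i - h) - N) (by simp [*, Op.eval]) (by omega) ?_
  refine wp_load_seq (h * N + (i - h) - N) y₂ (by simp [*]) (by simp [*]) (by omega) ?_
  refine wp_arith_seq (c * h) (by simp [*, Op.eval]) (by omega) ?_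
  refine wp_arith_seq (c * h + c * h) (by simp [*, Op.eval]) (by omega) ?_
  refine wp_arith_seq (c * h + c * h + 1) (by simp [*, Op.eval]) (by omega) ?_
  refine wp_arith_seq (y₀ * (c * h + c * h + 1)) (by simp [*, Op.eval]) (by omega) ?_
  refine wp_arith_seq (c * h + 1) (by simp [*, Op.eval]) (by omega) ?_
  refine wp_arith_seq (y₁ * (c * h + 1)) (by simp [*, Op.eval]) (by omega) ?_
  refine wp_arith_seq (y₀ * (c * h + c * h + 1) + y₁ * (c * h + 1))
    (by simp [*, Op.eval]) (by omega) ?_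
  refine wp_arith_seq (1 - h) (by simp [*, Op.eval]) (by omega) ?_
  refine wp_arith_seq (1 - (1 - h)) (by simp [*, Op.eval]) (by omega) ?_
  refine wp_arith_seq (h - 1) (by simp [*, Op.eval]) (by omega) ?_
  refine wp_arith_seq (c * (h - 1)) (by simp [*, Op.eval]) (by omega) ?_
  refine wp_arith_seq (1 - (1 - h) + c * (h - 1)) (by simp [*, Op.eval]) (by omega) ?_
  refine wp_arith_seq (y₂ * (1 - (1 - h) + c * (h - 1))) (by simp [*, Op.eval]) (by omega) ?_
  refine wp_arith_seq x (by simp [*, Op.eval]) (by omega) ?_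
  refine wp_arith_seq (x * (1 - (h - i))) (by simp [*, Op.eval]) (by omega) ?_
  refine wp_store_seq (h * N + i) (x * (1 - (h - i))) (by simp [*]) (by simp [*]) (by omega) ?_
  refine wp_arith_seq (h + 1) (by simp [*, Op.eval]) (by omega) ?_
  refine wp_arith j (by simp [*, Op.eval]) (by omega) ?_
  refine ⟨fun r hr => ?_, by simp, by simp, by simp⟩
  interval_cases r <;> simp

/-- Updates the entries of one area for all heights. -/
def heightLoop : Prog :=
  .seq (.const 8 0) <|
  -- Only heights `0` to `n` are rewritten; row `n + 1` stays 0.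
  .seq (.arith .add 7 0 3) <|
  .seq (.loop 7 entryProg) <|
  .arith .sub 6 6 3

/-- Updates the whole table, by decreasing area. -/
def layerLoop : Prog :=
  .seq (.move 6 2) <|
  .seq (.loop 6 heightLoop) <|
  .arith .sub 5 5 3

/-- Computes the row length, initializes the table, updates it `n` times and reads the result. -/
def tableProg (c : ℕ) : Prog :=
  .seq (.const 3 1) <|
  .seq (.const 4 c) <|
  .seq (.arith .mul 2 0 0) <|
  .seq (.arith .add 2 2 3) <|
  .seq (.const 9 0) <|
  .seq (.store 9 3) <|
  .seq (.move 5 0) <|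
  .seq (.loop 5 layerLoop) <|
  -- Nonzero exactly if the second input is at most `n ^ 2`, which keeps the final load inside the
  -- table.
  .seq (.arith .sub 9 2 1) <|
  .cond 9 (.load 0 1) (.const 0 0)

/-! ### Invariants of the update in place -/

/-- The registers that are constant in the loops. -/
structure Fixed (n a c : ℕ) (s : State) : Prop where
  input : s.reg 0 = n
  second : s.reg 1 = a
  row : s.reg 2 = n * n + 1
  one : s.reg 3 = 1
  param : s.reg 4 = c

/-- The table while layer `k + 1` replaces layer `k`: the entries of area above `i`, and those of
area `i` and height below `h`, are new. -/
def Updating (n c k i h : ℕ) (s : State) : Prop :=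
  ∀ g ≤ n + 1, ∀ j ≤ n * n, s.mem (g * (n * n + 1) + j) =
    if i < j ∨ j = i ∧ g < h then table c (k + 1) g j else table c k g j

/-- The table after the update of the entries of area at least `i`. -/
def Updated (n c k i : ℕ) (s : State) : Prop :=
  ∀ g ≤ n + 1, ∀ j ≤ n * n, s.mem (g * (n * n + 1) + j) =
    if i ≤ j then table c (k + 1) g j else table c k g j

theorem weights_le {c n h : ℕ} (hc : c ≤ 1) (hh : h ≤ n) :
    upWeight c h + flatWeight c h + downWeight c h ≤ 4 * n + 4 := by
  have hch : c * h ≤ h := by simpa using Nat.mul_le_mul_right h hc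
  have hch' : c * (h - 1) ≤ h - 1 := by simpa using Nat.mul_le_mul_right (h - 1) hc
  simp only [upWeight, flatWeight, downWeight]
  omega

theorem table_le {c n k : ℕ} (hc : c ≤ 1) (hk : k ≤ n) (h s : ℕ) :
    table c k h s ≤ (4 * n + 4) ^ n :=
  (transfer_le (fun _ hh => weights_le hc hh) hk h s).trans
    (Nat.pow_le_pow_right (by omega) hk)

/-- Bounds for the space and for the computed numbers that suffice for the program. -/
structure Bounds (m w n : ℕ) : Prop where
  space : (n + 2) * (n * n + 1) ≤ m
  address : (n + 2) * (n * n + 1) ≤ w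
  value : (4 * n + 4) * (4 * n + 4) ^ n ≤ w

/-- The new entry needs old entries of area `i - h`. For `0 < h ≤ i` these have smaller area, not
yet touched when areas decrease; for `h = 0` they are the entry itself and the one above, still old
because heights increase. -/
theorem wp_entry_updating {m w n a c k l i j h : ℕ} {s : State} (hb : Bounds m w n) (hc : c ≤ 1)
    (hi : i ≤ n * n) (hk : k < n) (hF : Fixed n a c s) (h5 : s.reg 5 = l) (h6 : s.reg 6 = i + 1)
    (h7 : s.reg 7 = j + 1) (h8 : s.reg 8 = h) (hhj : h + j = n) (hU : Updating n c k i h s) :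
    Wp m w entryProg 30 (fun s' => Fixed n a c s' ∧ s'.reg 5 = l ∧ s'.reg 6 = i + 1 ∧
      s'.reg 7 = j ∧ s'.reg 8 = h + 1 ∧ Updating n c k i (h + 1) s') s := by
  have hh : h ≤ n := by omega
  have hB := table_le hc hk.le (c := c)
  have m0 : s.mem (h * (n * n + 1) + (i - h)) = table c k h (i - h) := by
    rw [hU h (by omega) (i - h) (by omega), if_neg (by omega)]
  have m1 : s.mem (h * (n * n + 1) + (i - h) + (n * n + 1)) = table c k (h + 1) (i - h) := by
    rw [show h * (n * n + 1) + (i - h) + (n * n + 1) = (h + 1) * (n * n + 1) + (i - h) by ring,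
      hU (h + 1) (by omega) (i - h) (by omega), if_neg (by omega)]
  -- The cell below need not hold the wanted entry. At `h = 0` the address truncates to cell 0, but
  -- the weight is 0; for `i < h` the cell may already be new, but the result is multiplied by 0.
  -- Only the bound is always required.
  obtain ⟨y, hy, m2, hyB⟩ : ∃ y,
      (h ≤ i → y * downWeight c h = downWeight c h * table c k (h - 1) (i - h)) ∧
      s.mem (h * (n * n + 1) + (i - h) - (n * n + 1)) = y ∧ y ≤ (4 * n + 4) ^ n := by
    rcases h with _ | h
    · refine ⟨_, fun _ => by simp [downWeight], rfl, ?_⟩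
      have := hU 0 (by omega) (i - (n * n + 1)) (by omega)
      rw [zero_mul, zero_add] at this
      rw [zero_mul, zero_add, Nat.sub_zero, this]
      split_ifs <;> exact table_le hc (by omega) _ _
    · rw [show (h + 1) * (n * n + 1) + (i - (h + 1)) - (n * n + 1) =
          h * (n * n + 1) + (i - (h + 1)) by rw [Nat.succ_mul]; omega,
        hU h (by omega) (i - (h + 1)) (by omega)]
      refine ⟨_, fun hhi => ?_, rfl, ?_⟩
      · rw [if_neg (by omega), Nat.add_sub_cancel, mul_comm]
      · split_ifs <;> exact table_le hc (by omega) _ _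
  refine (wp_entryProg (j := j) hc hh (by omega : i < n * n + 1) hb.space hb.address
    (Nat.one_le_pow _ _ (by omega)) hb.value (hB h (i - h)) (hB (h + 1) (i - h)) hyB hF.row hF.one
    hF.param h6 h7 h8 (by omega) m0 m1 m2).mono le_rfl ?_
  rintro s' ⟨hreg, h7', h8', hmem⟩
  refine ⟨⟨?_, ?_, ?_, ?_, ?_⟩, ?_, ?_, h7', h8', ?_⟩
  · rw [hreg 0 (by omega), hF.input]
  · rw [hreg 1 (by omega), hF.second]
  · rw [hreg 2 (by omega), hF.row]
  · rw [hreg 3 (by omega), hF.one]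
  · rw [hreg 4 (by omega), hF.param]
  · rw [hreg 5 (by omega), h5]
  · rw [hreg 6 (by omega), h6]
  · intro g hg t ht
    rw [hmem]
    by_cases he : g = h ∧ t = i
    · obtain ⟨rfl, rfl⟩ := he
      rw [Function.update_self, if_pos (by omega)]
      simp only [table, transfer]
      split_ifs with hgt
      · rw [hy hgt, Nat.sub_eq_zero_of_le hgt]; ring
      · rw [show 1 - (g - t) = 0 by omega, mul_zero]
    · have hne : g * (n * n + 1) + t ≠ h * (n * n + 1) + i := by
        intro e
        rcases lt_trichotomy g h with hlt | heq | hlt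
        · have := Nat.mul_le_mul_right (n * n + 1) (Nat.succ_le_of_lt hlt)
          rw [Nat.succ_mul] at this
          omega
        · subst heq; omega
        · have := Nat.mul_le_mul_right (n * n + 1) (Nat.succ_le_of_lt hlt)
          rw [Nat.succ_mul] at this
          omega
      rw [Function.update_of_ne hne, hU g hg t ht]
      congr 1
      rw [eq_iff_iff]
      omega

theorem wp_heightLoop {m w n a c k l i : ℕ} {s : State} (hb : Bounds m w n) (hc : c ≤ 1)
    (hi : i ≤ n * n) (hk : k < n) (hF : Fixed n a c s) (h5 : s.reg 5 = l) (h6 : s.reg 6 = i + 1)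
    (hU : Updated n c k (i + 1) s) :
    Wp m w heightLoop ((n + 1) * 31 + 4) (fun s' => Fixed n a c s' ∧ s'.reg 5 = l ∧
      s'.reg 6 = i ∧ Updated n c k i s') s := by
  have hw : n + 2 ≤ w := (Nat.le_mul_of_pos_right _ (by omega)).trans hb.address
  have hiw : i ≤ w := by
    have := hb.address
    have : n * n + 1 ≤ (n + 2) * (n * n + 1) := Nat.le_mul_of_pos_left _ (by omega)
    omega
  refine wp_const_seq (by omega) ?_
  refine wp_arith_seq (n + 1) (by simp [Op.eval, hF.input, hF.one]) (by omega) ?_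
  refine wp_seq (T := (n + 1) * 31 + 1) (T' := 1)
    ((wp_loop (fun j s' => Fixed n a c s' ∧ s'.reg 5 = l ∧
    s'.reg 6 = i + 1 ∧ s'.reg 7 = j ∧ j ≤ n + 1 ∧ s'.reg 8 = n + 1 - j ∧
      Updating n c k i (n + 1 - j) s')
    (fun _ _ h => h.2.2.2.1) (T := 30) ?_ (n + 1) _ ?_).mono le_rfl ?_)
  · rintro j s' ⟨hF', h5', h6', h7', hj, h8', hU'⟩
    refine (wp_entry_updating hb hc hi hk hF' h5' h6' h7' h8' (by omega) hU').mono le_rfl ?_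
    rintro s'' ⟨hF'', h5'', h6'', h7'', h8'', hU''⟩
    rw [show n + 1 - (j + 1) + 1 = n + 1 - j by omega] at h8'' hU''
    exact ⟨hF'', h5'', h6'', h7'', by omega, h8'', hU''⟩
  · refine ⟨⟨?_, ?_, ?_, ?_, ?_⟩, ?_, ?_, ?_, le_rfl, ?_, ?_⟩
    · simp [hF.input]
    · simp [hF.second]
    · simp [hF.row]
    · simp [hF.one]
    · simp [hF.param]
    · simp [h5]
    · simp [h6]
    · simp
    · simp
    · intro g hg t ht
      rw [mem_setReg, mem_setReg, hU g hg t ht]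
      congr 1
      rw [eq_iff_iff]
      omega
  · rintro s' ⟨hF', h5', h6', h7', -, h8', hU'⟩
    refine wp_arith i (by simp [Op.eval, h6', hF'.one]) hiw ?_
    refine ⟨⟨?_, ?_, ?_, ?_, ?_⟩, ?_, ?_, ?_⟩
    · simp [hF'.input]
    · simp [hF'.second]
    · simp [hF'.row]
    · simp [hF'.one]
    · simp [hF'.param]
    · simp [h5']
    · simp
    · intro g hg t ht
      rw [mem_setReg, hU' g hg t ht]
      -- The border row was not rewritten, but it is zero in both layers.
      by_cases hgn : g = n + 1
      · subst hgn
        rw [table, table, transfer_eq_zero_of_lt (by omega), transfer_eq_zero_of_lt (by omega)]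
        simp
      · congr 1
        rw [eq_iff_iff]
        omega

/-- The complete layer `k` of the table. -/
def Layer (n c k : ℕ) (s : State) : Prop :=
  ∀ g ≤ n + 1, ∀ j ≤ n * n, s.mem (g * (n * n + 1) + j) = table c k g j

theorem wp_layerLoop {m w n a c k l : ℕ} {s : State} (hb : Bounds m w n) (hc : c ≤ 1)
    (hkl : k + (l + 1) = n) (hF : Fixed n a c s) (h5 : s.reg 5 = l + 1) (hL : Layer n c k s) :
    Wp m w layerLoop ((n * n + 1) * ((n + 1) * 31 + 5) + 3) (fun s' => Fixed n a c s' ∧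
      s'.reg 5 = l ∧ Layer n c (k + 1) s') s := by
  have hw : n + 2 ≤ w := (Nat.le_mul_of_pos_right _ (by omega)).trans hb.address
  refine wp_move_seq (n * n + 1) hF.row ?_
  refine wp_seq (T := (n * n + 1) * ((n + 1) * 31 + 5) + 1) (T' := 1)
    ((wp_loop (fun i s' => Fixed n a c s' ∧ s'.reg 5 = l + 1 ∧ s'.reg 6 = i ∧
    i ≤ n * n + 1 ∧ Updated n c k i s')
    (fun _ _ h => h.2.2.1) (T := (n + 1) * 31 + 4) ?_ (n * n + 1) _ ?_).mono le_rfl ?_)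
  · rintro i s' ⟨hF', h5', h6', hi, hU'⟩
    refine (wp_heightLoop hb hc (by omega) (by omega) hF' h5' h6' hU').mono le_rfl ?_
    rintro s'' ⟨hF'', h5'', h6'', hU''⟩
    exact ⟨hF'', h5'', h6'', by omega, hU''⟩
  · refine ⟨⟨?_, ?_, ?_, ?_, ?_⟩, ?_, ?_, le_rfl, ?_⟩
    · simp [hF.input]
    · simp [hF.second]
    · simp [hF.row]
    · simp [hF.one]
    · simp [hF.param]
    · simp [h5]
    · simp
    · intro g hg t ht
      rw [mem_setReg, hL g hg t ht, if_neg (by omega)]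
  · rintro s' ⟨hF', h5', -, -, hU'⟩
    refine wp_arith l (by simp [Op.eval, h5', hF'.one]) (by omega) ?_
    refine ⟨⟨?_, ?_, ?_, ?_, ?_⟩, ?_, ?_⟩
    · simp [hF'.input]
    · simp [hF'.second]
    · simp [hF'.row]
    · simp [hF'.one]
    · simp [hF'.param]
    · simp
    · intro g hg t ht
      rw [mem_setReg, hU' g hg t ht, if_pos (by omega)]

theorem wp_tableProg {m w n a c : ℕ} (hb : Bounds m w n) (hc : c ≤ 1) (ha : n * n + 1 - a ≤ w) :
    Wp m w (tableProg c) (n * ((n * n + 1) * ((n + 1) * 31 + 5) + 4) + 11)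
      (fun s => s.reg 0 = table c n 0 a ∧ ∀ j ≤ n ^ 2, s.mem j = table c n 0 j)
      (initState n a) := by
  have hw : n + 2 ≤ w := (Nat.le_mul_of_pos_right _ (by omega)).trans hb.address
  have hN : n * n + 1 ≤ (n + 2) * (n * n + 1) := Nat.le_mul_of_pos_left _ (by omega)
  have hNw := hb.address
  have hNm := hb.space
  refine wp_const_seq (by omega) ?_
  refine wp_const_seq (by omega) ?_
  refine wp_arith_seq (n * n) (by simp [Op.eval, initState]) (by omega) ?_
  refine wp_arith_seq (n * n + 1) (by simp [Op.eval]) (by omega) ?_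
  refine wp_const_seq (by omega) ?_
  refine wp_store_seq 0 1 (by simp) (by simp) (by omega) ?_
  refine wp_move_seq n (by simp [initState]) ?_
  refine wp_seq (T := n * ((n * n + 1) * ((n + 1) * 31 + 5) + 4) + 1) (T' := 3)
    ((wp_loop (fun l s => Fixed n a c s ∧ s.reg 5 = l ∧ l ≤ n ∧ Layer n c (n - l) s)
    (fun _ _ h => h.2.1) (T := (n * n + 1) * ((n + 1) * 31 + 5) + 3) ?_ n _ ?_).mono le_rfl ?_)
  · rintro l s ⟨hF, h5, hl, hL⟩
    refine (wp_layerLoop hb hc (by omega) hF h5 hL).mono le_rfl ?_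
    rintro s' ⟨hF', h5', hL'⟩
    rw [show n - (l + 1) + 1 = n - l by omega] at hL'
    exact ⟨hF', h5', by omega, hL'⟩
  · refine ⟨⟨?_, ?_, ?_, ?_, ?_⟩, ?_, le_rfl, ?_⟩
    · simp [initState]
    · simp [initState]
    · simp
    · simp
    · simp
    · simp
    · intro g hg t ht
      simp only [mem_setReg, mem_setMem, Nat.sub_self, table, transfer, initState]
      rw [Function.update_apply]
      congr 1
      rw [eq_iff_iff, Nat.add_eq_zero_iff, Nat.mul_eq_zero]
      simp
  · rintro s ⟨hF, -, -, hL⟩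
    rw [Nat.sub_zero] at hL
    have hrow : ∀ j ≤ n ^ 2, s.mem j = table c n 0 j := by
      intro j hj
      have := hL 0 (by omega) j (by rwa [← sq])
      rwa [zero_mul, zero_add] at this
    refine wp_arith_seq (n * n + 1 - a) (by simp [Op.eval, hF.row, hF.second]) ha ?_
    by_cases ha' : a ≤ n * n
    · obtain ⟨t, s', h1, h2, h3⟩ : Wp m w (.load 0 1) 1
          (fun s => s.reg 0 = table c n 0 a ∧ ∀ j ≤ n ^ 2, s.mem j = table c n 0 j)
          (s.setReg 9 (n * n + 1 - a)) :=
        wp_load a (table c n 0 a) (by simp [hF.second])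
          (by rw [mem_setReg]; exact hrow a (by rwa [sq])) (by omega) ⟨by simp, by simpa using hrow⟩
      exact ⟨t + 1, s', by omega, .condTrue (by simp; omega) h2, h3⟩
    · obtain ⟨t, s', h1, h2, h3⟩ : Wp m w (.const 0 0) 1
          (fun s => s.reg 0 = table c n 0 a ∧ ∀ j ≤ n ^ 2, s.mem j = table c n 0 j)
          (s.setReg 9 (n * n + 1 - a)) :=
        wp_const (by omega)
          ⟨by rw [table, transfer_eq_zero_of_sq_lt (by rw [sq]; omega)]; simp, by simpa using hrow⟩
      exact ⟨t + 1, s', by omega, .condFalse (by simp; omega) h2, h3⟩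

/-- The entries are controlled by `4 * n + 4 ≤ (n + 2) ^ 2`. The constant 100 is generous; it also
covers the time, about 31 steps per table entry. -/
theorem bounds_of_large (n a : ℕ) :
    Bounds (100 * (n + 1) ^ 3) ((n + 2) ^ (100 * (n + 1)) + a) n where
  space := by nlinarith
  address := by
    calc (n + 2) * (n * n + 1) ≤ (n + 2) ^ 3 := by nlinarith
      _ ≤ (n + 2) ^ (100 * (n + 1)) := Nat.pow_le_pow_right (by omega) (by omega)
      _ ≤ _ := Nat.le_add_right _ _
  value := by
    calc (4 * n + 4) * (4 * n + 4) ^ n = (4 * n + 4) ^ (n + 1) := by rw [pow_succ']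
      _ ≤ ((n + 2) ^ 2) ^ (n + 1) := Nat.pow_le_pow_left (by nlinarith) _
      _ = (n + 2) ^ (2 * (n + 1)) := by rw [← pow_mul]
      _ ≤ (n + 2) ^ (100 * (n + 1)) := Nat.pow_le_pow_right (by omega) (by omega)
      _ ≤ _ := Nat.le_add_right _ _

theorem tableProg_computes {c : ℕ} (hc : c ≤ 1) :
    ComputesInQuarticTimeCubicSpace (tableProg c) fun n a => table c n 0 a := by
  refine ⟨100, fun n a => ?_⟩
  have hb := bounds_of_large n a
  have hN : n * n + 1 - a ≤ (n + 2) ^ (100 * (n + 1)) + a := by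
    have := hb.address
    have : n * n + 1 ≤ (n + 2) * (n * n + 1) := Nat.le_mul_of_pos_left _ (by omega)
    omega
  obtain ⟨t, s, h1, h2, h3, h4⟩ := wp_tableProg hb hc hN
  refine ⟨t, s, h1.trans ?_, h2, h3, h4⟩
  ring_nf
  nlinarith

theorem table_zero (n A : ℕ) : table 0 n 0 A = motzkinCount n A := by
  rw [motzkinCount_eq_transfer (d := downWeight 0) rfl (fun h => by simp [downWeight]),
    table, show upWeight 0 = fun _ => 1 by funext h; simp [upWeight],
    show flatWeight 0 = fun _ => 1 by funext h; simp [flatWeight]]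

theorem table_one (n d : ℕ) : table 1 n 0 d = displacementCount n d := by
  rw [displacementCount_eq_transfer, table,
    show upWeight 1 = fun h => h + 1 by funext h; simp [upWeight],
    show flatWeight 1 = fun h => 2 * h + 1 by funext h; simp [flatWeight]; omega,
    show downWeight 1 = fun h => h by funext h; simp [downWeight]; omega]

theorem exists_motzkinCount_prog : ∃ P : Prog, ComputesInQuarticTimeCubicSpace P motzkinCount := by
  refine ⟨tableProg 0, ?_⟩
  simpa only [table_zero] using tableProg_computes (c := 0) (by omega)

theorem exists_displacementCount_prog :
    ∃ P : Prog, ComputesInQuarticTimeCubicSpace P displacementCount := by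
  refine ⟨tableProg 1, ?_⟩
  simpa only [table_one] using tableProg_computes (c := 1) le_rfl

end MotzkinDP

theorem theorem2 :
    -- the computation of `M(n, A)` and of `D(n, d)`
    (∃ P : MotzkinDP.Prog,
      MotzkinDP.ComputesInQuarticTimeCubicSpace P MotzkinDP.motzkinCount) ∧
    (∃ P : MotzkinDP.Prog,
      MotzkinDP.ComputesInQuarticTimeCubicSpace P MotzkinDP.displacementCount) ∧
    -- the dynamic program for `M(n, A)`: marginals, base case, recurrence
    (∀ n A : ℕ, MotzkinDP.motzkinCount n A =
      ∑ l ∈ Finset.Icc (0 : ℤ) n, MotzkinDP.lastFallCount n A l) ∧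
    (∀ n A l : ℤ, n ≤ 0 →
      MotzkinDP.lastFallCount n A l = if n = 0 ∧ A = 0 ∧ l = 0 then 1 else 0) ∧
    (∀ n A l : ℤ, 1 ≤ n → 0 ≤ l →
      MotzkinDP.lastFallCount n A l =
        (∑ k ∈ Finset.Icc l (n / 2), MotzkinDP.lastFallCount (n - 1) (A - l) k) +
        (if l = 0 then 0 else
          ∑ k ∈ Finset.Icc (l - 1) (n / 2),
            MotzkinDP.lastFallCount (n - 2) (A - (2 * l - 1)) k)) ∧
    -- the dynamic program for `D(n, d)`: marginals, base case, recurrence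
    (∀ n d : ℕ, (MotzkinDP.displacementCount n d : ℤ) =
      ∑ l ∈ Finset.Icc (0 : ℤ) n, MotzkinDP.lastFallWeight n d l) ∧
    (∀ n d l : ℤ, n ≤ 0 →
      MotzkinDP.lastFallWeight n d l = if n = 0 ∧ d = 0 ∧ l = 0 then 1 else 0) ∧
    (∀ n d l : ℤ, 1 ≤ n → 0 ≤ l →
      MotzkinDP.lastFallWeight n d l =
        (2 * l + 1) *
          (∑ k ∈ Finset.Icc l (n / 2), MotzkinDP.lastFallWeight (n - 1) (d - l) k) +
        l ^ 2 *
          (∑ k ∈ Finset.Icc (l - 1) (n / 2),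
            MotzkinDP.lastFallWeight (n - 2) (d - (2 * l - 1)) k)) := by
  exact ⟨MotzkinDP.exists_motzkinCount_prog, MotzkinDP.exists_displacementCount_prog,
    MotzkinDP.motzkinCount_eq_sum, fun _ A l hn => MotzkinDP.lastFallCount_of_nonpos hn A l,
    fun _ _ _ hn hl => MotzkinDP.lastFallCount_recurrence hn hl,
    MotzkinDP.displacementCount_eq_sum, fun _ d l hn => MotzkinDP.lastFallWeight_of_nonpos hn d l,
    fun _ _ _ hn hl => MotzkinDP.lastFallWeight_recurrence hn hl⟩
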